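/- **Notation.** Write $e(x) := e^{2\pi i x}$ for $x \in \mathbf{R}/\mathbf{Z}$ and $[N] := \{1,\dots,N\}$. For a finite abelian group $G$ and $F : G \to \mathbf{C}$, let $T^hF(x) := F(x-h)$ and define the Gowers norms recursively by $$\|F\|_{U^1(G)} := \Big|\frac{1}{|G|}\sum_{x\in G} F(x)\Big|, \qquad \|F\|_{U^{k+1}(G)} := \Big(\frac{1}{|G|}\sum_{h\in G} \|(T^hF)\,\overline{F}\|_{U^k(G)}^{2^k}\Big)^{1/2^{k+1}} \quad (k\ge 1).$$ For $f : [N]\to\mathbf{C}$ and $k \geq 1$ put $$\|f\|_{U^k([N])} := \|\tilde f\|_{U^k(\mathbf{Z}/\tilde N\mathbf{Z})} \big/ \|1_{[N]}\|_{U^k(\mathbf{Z}/\tilde N\mathbf{Z})},$$ where $\tilde N$ is any integer with $\tilde N > 2^kN$ (the value does not depend on the choice of $\tilde N$), $[N]$ is embedded in $\mathbf{Z}/\tilde N\mathbf{Z}$ by reduction mod $\tilde N$, and $\tilde f$ is the extension of $f$ by zero. Put $\|f\|_{L^1([N])} := \frac1N\sum_{n=1}^N |f(n)|$. A map $P:\mathbf{Z}\to\mathbf{R}/\mathbf{Z}$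 is a polynomial of degree $\le d$ (for an integer $d \geq -1$) if $\Delta_{h_1}\cdots\Delta_{h_{d+1}}P(x)=0$ for all $x,h_1,\dots,h_{d+1}\in\mathbf{Z}$, where $\Delta_hP(x):=P(x-h)-P(x)$. **Theorem.** Let $k\ge 1$ be an integer. There exist an integer $N_0$ and a function $c : \mathbf{R} \to \mathbf{R}$ with $c(\varepsilon)\to 0$ as $\varepsilon\to 0$, $\varepsilon \geq 0$ (so that $c(0)=0$), both depending only on $k$, such that the following holds for every integer $N\ge 1$ with $N\ge N_0$ and every $f:[N]\to\mathbf{C}$ with $|f(n)|\le 1$ for all $n\in[N]$. 1. (Extremisers) $\|f\|_{U^k([N])}=1$ if and only if there is a polynomial $P:\mathbf{Z}\to\mathbf{R}/\mathbf{Z}$ of degree $\le k-1$ such that $f(n)=e(P(n))$ for all $n\in[N]$. 2. (Near-extremisers) For every $\varepsilon\ge 0$, if $\|f\|_{U^k([N])}\ge 1-\varepsilon$, then there is a polynomial $P:\mathbf{Z}\to\mathbf{R}/\mathbf{Z}$ of degree $\le k-1$ such that $\|f-e(P)\|_{L^1([N])}\le c(\varepsilon)$. -/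

import Mathlib

open Filter Topology

noncomputable section

namespace GowersInterval

/-- The shift `T^h f (x) = f (x - h)` on an abelian group. -/
def shift {G A : Type*} [AddCommGroup G] (h : G) (f : G → A) : G → A :=
  fun x => f (x - h)

/-- The difference operator `Δ_h P (x) = P (x - h) - P x`. -/
def diffOp {G H : Type*} [AddCommGroup G] [AddCommGroup H] (h : G) (P : G → H) : G → H :=
  fun x => shift h P x - P x

/-- `P : G → H`, with `G` a discrete abelian group, is a polynomial map of degree at most `d`
(where `d ≥ -1`): one has `Δ_{h_1} ⋯ Δ_{h_{d+1}} P (x) = 0` for all `h_1, …, h_{d+1}, x` in `G`.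
On a discrete group "almost every" means "every". -/
def IsPolynomialOfDegreeLE {G H : Type*} [AddCommGroup G] [AddCommGroup H]
    (d : ℤ) (P : G → H) : Prop :=
  ∀ hs : List G, (hs.length : ℤ) = d + 1 → ∀ x : G, hs.foldr diffOp P x = 0

/-- The standard character `e(x) = exp(2πix)` of `ℝ/ℤ`, as a complex number. -/
def e (x : UnitAddCircle) : ℂ := (AddCircle.toCircle x : ℂ)

/-- The Gowers norm `‖f‖_{U^k(G)}`, `k ≥ 1`, on a finite abelian group with the normalised
counting measure, by recursion on `k`:
`‖f‖_{U^1} = |𝔼_x f(x)|` and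
`‖f‖_{U^{k+1}} = (𝔼_h ‖(T^h f) · conj f‖_{U^k}^{2^k})^{1/2^{k+1}}`.
The value at `k = 0` is a placeholder. -/
def gowersNorm {G : Type*} [AddCommGroup G] [Fintype G] : ℕ → (G → ℂ) → ℝ
  | 0, _ => 0
  | 1, f => ‖(∑ x, f x) / (Fintype.card G : ℂ)‖
  | k + 2, f =>
      ((∑ h : G, gowersNorm (k + 1) (fun x => shift h f x * (starRingEnd ℂ) (f x)) ^ 2 ^ (k + 1))
        / (Fintype.card G : ℝ)) ^ ((1 : ℝ) / 2 ^ (k + 2))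

/-- The discrete interval `[N] = {1, …, N}`. -/
abbrev Interval (N : ℕ) : Type := Set.Icc (1 : ℤ) (N : ℤ)

/-- For `M > N`, the extension by zero of `f : [N] → ℂ` to `ℤ/Mℤ`, where `[N]` is embedded in
`ℤ/Mℤ` by reduction mod `M`; `x.val` is the representative of `x` in `{0, …, M - 1}`. -/
def extendZero {N : ℕ} (M : ℕ) (f : Interval N → ℂ) : ZMod M → ℂ :=
  fun x => if hx : (x.val : ℤ) ∈ Set.Icc (1 : ℤ) (N : ℤ) then f ⟨(x.val : ℤ), hx⟩ else 0

/-- The Gowers norm `‖f‖_{U^k([N])}`, computed in the cyclic group `ℤ/Mℤ`. Any `M > 2^k N` is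
admissible; the value is the same for all of them. -/
def gowersNormInterval (k : ℕ) {N : ℕ} (M : ℕ) [NeZero M] (f : Interval N → ℂ) : ℝ :=
  gowersNorm k (extendZero M f) / gowersNorm k (extendZero M (fun _ : Interval N => (1 : ℂ)))

/-- The norm of `L^1([N])`, for the normalised counting measure on `[N]`. -/
def l1Norm {N : ℕ} (f : Interval N → ℂ) : ℝ :=
  (∑ n, ‖f n‖) / (N : ℝ)

end GowersInterval

end

noncomputable section

namespace GowersInterval

/-! The `2^k`-th power of the norm on `[N]` is the average, over the `k`-dimensional cubes of
integers contained in `[N]`, of the product of `f` or its conjugate over the vertices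
(`gowersNorm_pow`, `gowersNormInterval_pow`). Write `f = |f| e(φ)`. If the norm is close to 1, these
products have real part close to 1 on average. Hence `|f|` is close to 1 on average, and by
Cauchy–Schwarz the alternating sums of `φ` over cubes are small in the circle on average
(`sum_one_sub_re_le`, `sum_norm_cubeDiff_le`).

Two stability results turn this into a polynomial. The first is self-correction
(`exists_correction`). Each cube based at `x` predicts `φ x` from its other vertices, and different
cubes mostly agree, so some `g x` is close to the predictions on average. Away from the ends of the
interval `g` is close to `φ` in `L^1`. A cube of cubes can be summed in two orders, and this makes
the `k`-th differences of `g` small on every cube of the shortened interval, not just on most of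
them.

The second is a uniform statement (`exists_circle_polynomial_near`). A circle-valued function with
uniformly small differences has a real lift with the same property (`exists_lift_unit_steps`,
`abs_cubeDiff_lift_le`). A discrete Whitney theorem (`exists_polynomial_near`) then subtracts one
monomial at a time, the leading coefficient coming from stability of multiadditive functions.

The margin lost at the ends costs a multiple of `κ`; it is fixed first, and `ε` is then taken small
in terms of it. For norm exactly 1 no correction is needed: all differences of `φ` vanish on cubes
with nonnegative steps, and the uniform statement with error 0 applies to the whole interval. -/

/-! ### Alternating sums over cubes and polynomial maps. -/

/-- The partial sum of the steps `h i` selected by `ω`. -/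
def dot {k : ℕ} {G : Type*} [AddCommGroup G] (ω : Fin k → Bool) (h : Fin k → G) : G :=
  ∑ i, if ω i then h i else 0

/-- The sign of the vertex `ω` of the discrete cube: `(-1)` to the number of `false` entries. -/
def sgn {k : ℕ} (ω : Fin k → Bool) : ℤ := ∏ i, if ω i then 1 else -1

/-- The iterated difference `Δ_{h_1} ⋯ Δ_{h_k} φ (x)` as an alternating sum over a cube. -/
def cubeDiff {k : ℕ} {G H : Type*} [AddCommGroup G] [AddCommGroup H] (h : Fin k → G) (φ : G → H)
    (x : G) : H :=
  ∑ ω : Fin k → Bool, sgn ω • φ (x - dot ω h)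

theorem sgn_eq_or {k : ℕ} (ω : Fin k → Bool) : sgn ω = 1 ∨ sgn ω = -1 := by
  unfold sgn
  induction (Finset.univ : Finset (Fin k)) using Finset.induction_on with
  | empty => simp
  | insert a s ha ih =>
    rw [Finset.prod_insert ha]
    rcases ih with ih | ih <;> rw [ih] <;> split_ifs <;> simp

theorem sgn_mul_self {k : ℕ} (ω : Fin k → Bool) : sgn ω * sgn ω = 1 := by
  rcases sgn_eq_or ω with h | h <;> simp [h]

theorem norm_sgn_smul {k : ℕ} {E : Type*} [SeminormedAddCommGroup E] (ω : Fin k → Bool) (x : E) :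
    ‖sgn ω • x‖ = ‖x‖ := by
  rcases sgn_eq_or ω with h | h <;> simp [h]

theorem sgn_insertNth {k : ℕ} (i : Fin (k + 1)) (b : Bool) (ω : Fin k → Bool) :
    sgn (i.insertNth b ω : Fin (k + 1) → Bool) = (if b then 1 else -1) * sgn ω := by
  simp [sgn, Fin.prod_univ_succAbove _ i]

section
variable {k : ℕ} {G H : Type*} [AddCommGroup G] [AddCommGroup H]

theorem dot_insertNth (i : Fin (k + 1)) (b : Bool) (ω : Fin k → Bool) (a : G) (h : Fin k → G) :
    dot (i.insertNth b ω : Fin (k + 1) → Bool) (i.insertNth a h : Fin (k + 1) → G)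
      = (if b then a else 0) + dot ω h := by
  simp [dot, Fin.sum_univ_succAbove _ i]

@[simp] theorem dot_false (h : Fin k → G) : dot (fun _ => false) h = 0 := by simp [dot]

theorem dot_single (i : Fin k) (h : Fin k → G) : dot (fun j => decide (j = i)) h = h i := by
  simp [dot]

theorem sum_insertNth {A : Type*} [AddCommMonoid A] (i : Fin (k + 1))
    (F : (Fin (k + 1) → Bool) → A) :
    ∑ ω, F ω = (∑ ω : Fin k → Bool, F (i.insertNth true ω))
      + ∑ ω : Fin k → Bool, F (i.insertNth false ω) := by
  rw [← (Fin.insertNthEquiv (fun _ => Bool) i).sum_comp, Fintype.sum_prod_type]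
  simp [Fin.insertNthEquiv]

theorem cubeDiff_insertNth (i : Fin (k + 1)) (a : G) (h : Fin k → G) (φ : G → H) (x : G) :
    cubeDiff (i.insertNth a h : Fin (k + 1) → G) φ x
      = cubeDiff h φ (x - a) - cubeDiff h φ x := by
  simp only [cubeDiff]
  rw [sum_insertNth i]
  simp only [sgn_insertNth, dot_insertNth, if_true, Bool.false_eq_true, if_false, one_mul,
    zero_add, neg_mul, neg_smul, Finset.sum_neg_distrib, sub_eq_add_neg, neg_add, add_assoc]

theorem cubeDiff_cons (a : G) (h : Fin k → G) (φ : G → H) (x : G) :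
    cubeDiff (Fin.cons a h : Fin (k + 1) → G) φ x = cubeDiff h φ (x - a) - cubeDiff h φ x := by
  have := cubeDiff_insertNth (0 : Fin (k + 1)) a h φ x
  rwa [Fin.insertNth_zero'] at this

/-- This is the cocycle identity for differences in a single direction. Every later argument that
splits or exchanges a step rests on it. -/
theorem cubeDiff_update (h : Fin k → G) (i : Fin k) (s s' : G) (φ : G → H) (x : G) :
    cubeDiff (Function.update h i (s + s')) φ x
      = cubeDiff (Function.update h i s) φ x + cubeDiff (Function.update h i s') φ (x - s) := by
  cases k with
  | zero => exact i.elim0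
  | succ k =>
    have key : ∀ a, Function.update h i a = i.insertNth a (i.removeNth h) := fun a => by simp
    simp only [key, cubeDiff_insertNth, sub_add_eq_sub_sub]
    abel

theorem cubeDiff_zero (h : Fin 0 → G) (φ : G → H) (x : G) : cubeDiff h φ x = φ x := by
  simp [cubeDiff, sgn, dot]

theorem cubeDiff_add (h : Fin k → G) (φ ψ : G → H) (x : G) :
    cubeDiff h (fun y => φ y + ψ y) x = cubeDiff h φ x + cubeDiff h ψ x := by
  simp [cubeDiff, Finset.sum_add_distrib]

theorem cubeDiff_sub (h : Fin k → G) (φ ψ : G → H) (x : G) :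
    cubeDiff h (fun y => φ y - ψ y) x = cubeDiff h φ x - cubeDiff h ψ x := by
  simp [cubeDiff, Finset.sum_sub_distrib, smul_sub]

theorem cubeDiff_map {H' : Type*} [AddCommGroup H'] (T : H →+ H') (h : Fin k → G) (φ : G → H)
    (x : G) : cubeDiff h (fun y => T (φ y)) x = T (cubeDiff h φ x) := by
  simp [cubeDiff, map_sum]

theorem cubeDiff_translate (h : Fin k → G) (φ : G → H) (a x : G) :
    cubeDiff h (fun y => φ (y - a)) x = cubeDiff h φ (x - a) := by
  simp only [cubeDiff]
  exact Finset.sum_congr rfl fun ω _ => by rw [sub_right_comm]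

theorem cubeDiff_diffOp (h : Fin k → G) (φ : G → H) (a x : G) :
    cubeDiff h (diffOp a φ) x = cubeDiff (Fin.cons a h : Fin (k + 1) → G) φ x := by
  rw [cubeDiff_cons, ← cubeDiff_translate, ← cubeDiff_sub]
  rfl

theorem cubeDiff_eq_zero_of_step (h : Fin k → G) (i : Fin k) (hi : h i = 0) (φ : G → H) (x : G) :
    cubeDiff h φ x = 0 := by
  have hu : Function.update h i 0 = h := by rw [← hi, Function.update_eq_self]
  simpa [hu] using cubeDiff_update h i 0 0 φ x

theorem foldr_diffOp_eq (l : List G) (φ : G → H) (x : G) :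
    l.foldr diffOp φ x = cubeDiff l.get φ x := by
  induction l generalizing x with
  | nil => simp [cubeDiff, sgn, dot]
  | cons a l ih =>
    have : (a :: l).get = (Fin.cons a l.get : Fin (l.length + 1) → G) := by
      funext j; refine Fin.cases ?_ (fun j => ?_) j <;> rfl
    rw [this, cubeDiff_cons, ← ih, ← ih]
    rfl

theorem isPolynomialOfDegreeLE_iff (φ : G → H) :
    IsPolynomialOfDegreeLE ((k : ℤ) - 1) φ ↔ ∀ (h : Fin k → G) (x : G), cubeDiff h φ x = 0 := by
  constructor
  · intro hφ h x
    have key : ∀ (l : List G) (hl : l.length = k), cubeDiff l.get φ x = 0 := by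
      intro l hl
      rw [← foldr_diffOp_eq]
      exact hφ l (by rw [hl]; ring) x
    have := key (List.ofFn h) (by simp)
    have hget : ∀ (m : ℕ) (hm : k = m) (h' : Fin m → G),
        (∀ i : Fin k, h' (Fin.cast hm i) = h i) → cubeDiff h' φ x = cubeDiff h φ x := by
      rintro m rfl h' hh
      congr 1
      funext i
      exact hh i
    rw [← this]
    exact (hget _ (by simp) _ (fun i => by simp)).symm
  · intro hφ l hl x
    have hl' : l.length = k := by omega
    subst hl'
    rw [foldr_diffOp_eq]
    exact hφ _ _

end

/-! ### Real lifts of circle-valued functions. -/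

theorem exists_primitive (χ : ℤ → ℝ) (c : ℝ) :
    ∃ ψ : ℤ → ℝ, ψ 0 = c ∧ ∀ x, ψ (x - 1) - ψ x = χ x := by
  refine ⟨fun x => c - ∑ i ∈ Finset.Ioc 0 x, χ i + ∑ i ∈ Finset.Ioc x 0, χ i, by simp, fun x => ?_⟩
  rcases lt_or_ge 0 x with hx | hx
  · have h1 : Finset.Ioc 0 x = insert x (Finset.Ioc 0 (x - 1)) := by
      ext j; simp only [Finset.mem_Ioc, Finset.mem_insert]; omega
    have h2 : Finset.Ioc x 0 = ∅ := Finset.Ioc_eq_empty (by omega)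
    have h3 : Finset.Ioc (x - 1) 0 = ∅ := Finset.Ioc_eq_empty (by omega)
    simp only [h1, h2, h3]
    rw [Finset.sum_insert (by simp)]
    simp
  · have h1 : Finset.Ioc (x - 1) 0 = insert x (Finset.Ioc x 0) := by
      ext j; simp only [Finset.mem_Ioc, Finset.mem_insert]; omega
    have h2 : Finset.Ioc 0 x = ∅ := Finset.Ioc_eq_empty (by omega)
    have h3 : Finset.Ioc 0 (x - 1) = ∅ := Finset.Ioc_eq_empty (by omega)
    simp only [h1, h2, h3]
    rw [Finset.sum_insert (by simp)]
    simp

theorem exists_real_lift (z : UnitAddCircle) : ∃ r : ℝ, (r : UnitAddCircle) = z ∧ |r| = ‖z‖ := by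
  induction z using QuotientAddGroup.induction_on with
  | H x =>
    refine ⟨x - round x, ?_, (UnitAddCircle.norm_eq).symm⟩
    rw [AddCircle.coe_sub, sub_eq_self, AddCircle.coe_eq_zero_iff]
    exact ⟨round x, by simp⟩

theorem cubeDiff_coe {k : ℕ} {G : Type*} [AddCommGroup G] (h : Fin k → G) (ψ : G → ℝ) (x : G) :
    cubeDiff h (fun y => (ψ y : UnitAddCircle)) x = ((cubeDiff h ψ x : ℝ) : UnitAddCircle) :=
  cubeDiff_map (QuotientAddGroup.mk' (AddSubgroup.zmultiples (1 : ℝ))) h ψ x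

/-- A circle-valued function has a real lift whose `k`-th difference with unit steps is the
smallest lift of the `k`-th difference of the function. -/
theorem exists_lift_unit_steps (k : ℕ) (φ : ℤ → UnitAddCircle) :
    ∃ ψ : ℤ → ℝ, (∀ x, (ψ x : UnitAddCircle) = φ x) ∧
      ∀ x, |cubeDiff (fun _ : Fin k => (1 : ℤ)) ψ x| = ‖cubeDiff (fun _ : Fin k => (1 : ℤ)) φ x‖ := by
  induction k generalizing φ with
  | zero =>
    choose r hr using exists_real_lift
    exact ⟨fun x => r (φ x), fun x => (hr _).1, fun x => by
      rw [cubeDiff_zero, cubeDiff_zero]; exact (hr _).2⟩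
  | succ k ih =>
    obtain ⟨χ, hχ, hχ'⟩ := ih (diffOp 1 φ)
    obtain ⟨c, hc, -⟩ := exists_real_lift (φ 0)
    -- Integrating the good lift `χ` of the first difference keeps its higher differences; the
    -- constant of integration is a lift of `φ 0`.
    obtain ⟨ψ, hψ0, hψ⟩ := exists_primitive χ c
    have hone : (fun _ : Fin (k + 1) => (1 : ℤ)) = Fin.cons 1 (fun _ : Fin k => (1 : ℤ)) := by
      funext j; refine Fin.cases ?_ (fun j => ?_) j <;> rfl
    have hdiff : diffOp 1 ψ = χ := funext hψ
    have hstep : ∀ x, ((ψ (x - 1) : ℝ) : UnitAddCircle) - (ψ x : UnitAddCircle)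
        = φ (x - 1) - φ x := fun x => by
      rw [← AddCircle.coe_sub, hψ, hχ]; rfl
    refine ⟨ψ, fun x => ?_, fun x => ?_⟩
    · induction x using Int.induction_on with
      | zero => rw [hψ0, hc]
      | succ i hi =>
        have := hstep (i + 1)
        rw [add_sub_cancel_right, hi] at this
        exact sub_right_injective this
      | pred i hi =>
        have := hstep (-i)
        rw [hi] at this
        exact sub_left_injective this
    · rw [hone, ← cubeDiff_diffOp, ← cubeDiff_diffOp, hdiff, hχ']

theorem sum_update {k : ℕ} (h : Fin k → ℤ) (i : Fin k) (s : ℤ) :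
    ∑ j, Function.update h i s j = ∑ j, h j - h i + s := by
  rw [Finset.sum_update_of_mem (Finset.mem_univ i), ← Finset.add_sum_erase _ h (Finset.mem_univ i),
    Finset.sdiff_singleton_eq_erase]
  ring

theorem update_nonneg {k : ℕ} {h : Fin k → ℤ} (hh : ∀ i, 0 ≤ h i) (i : Fin k) {s : ℤ}
    (hs : 0 ≤ s) (j : Fin k) : 0 ≤ Function.update h i s j := by
  rcases eq_or_ne j i with rfl | hj
  · simpa
  · simpa [hj] using hh j

/-- If a lift has small differences with unit steps, its differences are the small lifts for all
cubes. -/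
theorem abs_cubeDiff_lift_le {k : ℕ} {A B : ℤ} {δ : ℝ} (hδ : 3 * δ < 1) {φ : ℤ → UnitAddCircle}
    {ψ : ℤ → ℝ} (hψ : ∀ x, (ψ x : UnitAddCircle) = φ x)
    (hunit : ∀ x, |cubeDiff (fun _ : Fin k => (1 : ℤ)) ψ x|
      = ‖cubeDiff (fun _ : Fin k => (1 : ℤ)) φ x‖)
    (hφ : ∀ h : Fin k → ℤ, (∀ i, 0 ≤ h i) → ∀ x, x ≤ B → A ≤ x - ∑ i, h i →
      ‖cubeDiff h φ x‖ ≤ δ)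
    (h : Fin k → ℤ) (hh : ∀ i, 0 ≤ h i) (x : ℤ) (hx : x ≤ B) (hA : A ≤ x - ∑ i, h i) :
    |cubeDiff h ψ x| ≤ δ := by
  have hφψ : φ = fun y => (ψ y : UnitAddCircle) := funext fun y => (hψ y).symm
  have hδ0 : 0 ≤ δ := (norm_nonneg _).trans (hφ h hh x hx hA)
  induction hn : (∑ i, h i).toNat using Nat.strong_induction_on generalizing h x with
  | _ n ih =>
    have hsum : 0 ≤ ∑ i, h i := Finset.sum_nonneg fun i _ => hh i
    by_cases h0 : ∃ i, h i = 0
    · obtain ⟨i, hi⟩ := h0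
      simpa [cubeDiff_eq_zero_of_step h i hi] using hδ0
    -- A step of length at least 2 is cut into `h i - 1` and `1`; both resulting cubes lie in the
    -- interval and have smaller total step.
    by_cases h1 : ∃ i, 2 ≤ h i
    · obtain ⟨i, hi⟩ := h1
      have hs1 := sum_update h i (h i - 1)
      have hs2 := sum_update h i 1
      have hle : h i ≤ ∑ j, h j := Finset.single_le_sum (fun j _ => hh j) (Finset.mem_univ i)
      have b1 := ih _ (by rw [hs1]; omega) (Function.update h i (h i - 1))
        (update_nonneg hh i (by omega)) x hx (by rw [hs1]; omega) rfl
      have b2 := ih _ (by rw [hs2]; omega) (Function.update h i 1)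
        (update_nonneg hh i (by omega)) (x - (h i - 1)) (by omega) (by rw [hs2]; omega) rfl
      have hadd := cubeDiff_update h i (h i - 1) 1 ψ x
      rw [sub_add_cancel, Function.update_eq_self] at hadd
      have hbig : |cubeDiff h ψ x| ≤ 2 * δ := by
        rw [hadd]; exact (abs_add_le _ _).trans (by linarith)
      have hcirc := hφ h hh x hx hA
      rw [hφψ, cubeDiff_coe, UnitAddCircle.norm_eq] at hcirc
      -- The real difference is at most `2δ` and lies within `δ` of its nearest integer, which is
      -- therefore less than 1 in absolute value.
      have hround : round (cubeDiff h ψ x) = 0 := by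
        have : |(round (cubeDiff h ψ x) : ℝ)| < 1 := by
          have := abs_sub_abs_le_abs_sub (round (cubeDiff h ψ x) : ℝ) (cubeDiff h ψ x)
          rw [abs_sub_comm] at this
          linarith
        rw [← Int.cast_abs] at this
        exact Int.abs_lt_one_iff.1 (by exact_mod_cast this)
      simpa [hround] using hcirc
    · push Not at h0 h1
      have : h = fun _ => 1 := by
        funext i
        have := h0 i; have := h1 i; have := hh i
        omega
      subst this
      rw [hunit]
      exact hφ _ hh x hx hA

/-! ### Uniform stability: from nearly additive functions to Whitney's theorem. -/

/-- Stability of additive functions on an initial segment of the integers. -/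
theorem abs_sub_linear_le {τ : ℤ → ℝ} {L : ℤ} (hL : 0 < L) {δ : ℝ}
    (hτ : ∀ s s', 0 ≤ s → 0 ≤ s' → s + s' ≤ L → |τ (s + s') - τ s - τ s'| ≤ δ) (s : ℤ)
    (hs : 0 ≤ s) (hsL : s ≤ L) : |τ s - s / L * τ L| ≤ 3 * δ := by
  have hL' : (L : ℝ) ≠ 0 := by exact_mod_cast hL.ne'
  set β : ℤ → ℝ := fun s => τ s - s / L * τ L with hβ
  have hadd : ∀ s s', 0 ≤ s → 0 ≤ s' → s + s' ≤ L → |β (s + s') - β s - β s'| ≤ δ := by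
    intro s s' h1 h2 h3
    have : β (s + s') - β s - β s' = τ (s + s') - τ s - τ s' := by
      simp only [hβ]; push_cast; field_simp; ring
    rw [this]; exact hτ s s' h1 h2 h3
  have hβL : β L = 0 := by simp only [hβ]; field_simp; ring
  -- At a maximum of `|β|` in the first half of the segment, doubling gives `|β m| ≤ δ`. In the
  -- second half, `β L = 0` allows reflection to `L - m`, which doubling controls.
  obtain ⟨m, hm, hmax⟩ := Finset.exists_max_image (Finset.Icc 0 L) (fun s => |β s|)
    ⟨0, Finset.mem_Icc.2 ⟨le_rfl, hL.le⟩⟩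
  simp only [Finset.mem_Icc] at hm hmax
  refine (hmax s ⟨hs, hsL⟩).trans ?_
  have hδ : 0 ≤ δ := (abs_nonneg _).trans (hadd 0 0 le_rfl le_rfl (by omega))
  have double : ∀ t, 0 ≤ t → 2 * t ≤ L → 2 * |β t| ≤ |β m| + δ := by
    intro t h1 h2
    have a1 := hadd t t h1 h1 (by omega)
    have a2 := hmax (t + t) ⟨by omega, by omega⟩
    have a3 := abs_le.1 a1
    have a4 := abs_le.1 a2
    rcases abs_cases (β t) with ⟨e, -⟩ | ⟨e, -⟩ <;> rw [e] <;> linarith [a3.1, a3.2, a4.1, a4.2]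
  rcases le_total (2 * m) L with h | h
  · have := double m hm.1 h
    linarith
  · have d := double (L - m) (by omega) (by omega)
    have a := hadd m (L - m) hm.1 (by omega) (by omega)
    rw [add_sub_cancel, hβL] at a
    have : |β m| ≤ |β (L - m)| + δ := by
      rcases abs_cases (β m) with ⟨e, -⟩ | ⟨e, -⟩ <;> rw [e] <;>
        linarith [(abs_le.1 a).1, (abs_le.1 a).2, neg_abs_le (β (L - m)), le_abs_self (β (L - m))]
    linarith

theorem update_mem_box {k : ℕ} {h : Fin k → ℤ} {L : ℤ} (hh : ∀ i, 0 ≤ h i ∧ h i ≤ L) (i : Fin k)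
    {s : ℤ} (hs : 0 ≤ s ∧ s ≤ L) (j : Fin k) :
    0 ≤ Function.update h i s j ∧ Function.update h i s j ≤ L := by
  rcases eq_or_ne j i with rfl | hj
  · simpa
  · simpa [hj] using hh j

/-- Stability of multiadditive functions on a box. -/
theorem abs_sub_multilinear_le {k : ℕ} {T : (Fin k → ℤ) → ℝ} {L : ℤ} (hL : 0 < L) {δ : ℝ}
    (hT : ∀ h, (∀ i, 0 ≤ h i ∧ h i ≤ L) → ∀ i s s', 0 ≤ s → 0 ≤ s' → s + s' ≤ L →
      |T (Function.update h i (s + s')) - T (Function.update h i s)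
        - T (Function.update h i s')| ≤ δ)
    (h : Fin k → ℤ) (hh : ∀ i, 0 ≤ h i ∧ h i ≤ L) :
    |T h - (∏ i, (h i : ℝ) / L) * T (fun _ => L)| ≤ 3 * k * δ := by
  have hL' : (0 : ℝ) < L := by exact_mod_cast hL
  -- The coordinates in `s` are pushed to the endpoint `L` one at a time. The factors `h i / L` are
  -- at most 1, so the errors simply add.
  have key : ∀ s : Finset (Fin k),
      |T h - (∏ i ∈ s, (h i : ℝ) / L) * T (s.piecewise (fun _ => L) h)| ≤ 3 * s.card * δ := by
    intro s
    induction s using Finset.induction_on with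
    | empty => simp
    | insert j s hj ih =>
      have hbox : ∀ i, 0 ≤ s.piecewise (fun _ => L) h i ∧ s.piecewise (fun _ => L) h i ≤ L := by
        intro i
        by_cases hi : i ∈ s
        · simp [hi, hL.le]
        · simpa [hi] using hh i
      have h1 := abs_sub_linear_le (τ := fun t => T (Function.update
        (s.piecewise (fun _ => L) h) j t)) hL (fun t t' => hT _ hbox j t t') (h j) (hh j).1 (hh j).2
      have hself : Function.update (s.piecewise (fun _ => L) h) j (h j)
          = s.piecewise (fun _ => L) h := by
        conv_lhs => rw [← Finset.piecewise_eq_of_notMem s (fun _ => L) h hj]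
        exact Function.update_eq_self _ _
      simp only [hself] at h1
      rw [Finset.prod_insert hj, Finset.piecewise_insert, Finset.card_insert_of_notMem hj]
      have hfac : ∀ i, 0 ≤ (h i : ℝ) / L ∧ (h i : ℝ) / L ≤ 1 := fun i =>
        ⟨div_nonneg (by exact_mod_cast (hh i).1) hL'.le,
          (div_le_one hL').2 (by exact_mod_cast (hh i).2)⟩
      have hp0 : 0 ≤ ∏ i ∈ s, (h i : ℝ) / L := Finset.prod_nonneg fun i _ => (hfac i).1
      have hp1 : ∏ i ∈ s, (h i : ℝ) / L ≤ 1 :=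
        Finset.prod_le_one (fun i _ => (hfac i).1) fun i _ => (hfac i).2
      set p := ∏ i ∈ s, (h i : ℝ) / L
      set U := T (s.piecewise (fun _ => L) h)
      set V := T (Function.update (s.piecewise (fun _ => L) h) j L)
      have : T h - h j / L * p * V = (T h - p * U) + p * (U - h j / L * V) := by ring
      rw [this]
      refine (abs_add_le _ _).trans ?_
      rw [abs_mul, abs_of_nonneg hp0]
      have := mul_le_mul hp1 h1 (abs_nonneg _) zero_le_one
      push_cast
      linarith
  simpa using key Finset.univ

theorem cubeDiff_sum_mul {k : ℕ} {G ι : Type*} [AddCommGroup G] (s : Finset ι) (h : Fin k → G)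
    (c : ι → ℝ) (f : ι → G → ℝ) (x : G) :
    cubeDiff h (fun y => ∑ i ∈ s, c i * f i y) x = ∑ i ∈ s, c i * cubeDiff h (f i) x := by
  simp only [cubeDiff, Finset.mul_sum, Finset.smul_sum]
  rw [Finset.sum_comm]
  exact Finset.sum_congr rfl fun i _ => Finset.sum_congr rfl fun ω _ => by
    rw [mul_smul_comm]

/-- By the binomial theorem, one difference with step `a` lowers the degree and multiplies the
leading coefficient by `-a * j`. The sign arises because steps are subtracted. -/
theorem cubeDiff_pow {k j : ℕ} (hj : j ≤ k) (h : Fin k → ℤ) (x : ℤ) :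
    cubeDiff h (fun y : ℤ => (y : ℝ) ^ j) x
      = if j = k then (-1) ^ k * k.factorial * ∏ i, (h i : ℝ) else 0 := by
  induction k generalizing j x with
  | zero =>
    obtain rfl : j = 0 := by omega
    simp [cubeDiff_zero]
  | succ k ih =>
    obtain ⟨a, h, rfl⟩ : ∃ (a : ℤ) (h' : Fin k → ℤ), h = Fin.cons a h' :=
      ⟨h 0, Fin.tail h, (Fin.cons_self_tail h).symm⟩
    have hexp : ∀ y : ℤ, ((y - a : ℤ) : ℝ) ^ j - (y : ℝ) ^ j
        = ∑ i ∈ Finset.range j, ((-(a : ℝ)) ^ (j - i) * (j.choose i)) * (y : ℝ) ^ i := by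
      intro y
      rw [Int.cast_sub, sub_eq_add_neg (y : ℝ), add_pow, Finset.sum_range_succ]
      simp only [Nat.sub_self, pow_zero, mul_one, Nat.choose_self, Nat.cast_one, add_sub_cancel_right]
      exact Finset.sum_congr rfl fun i _ => by ring
    rw [cubeDiff_cons, ← cubeDiff_translate, ← cubeDiff_sub]
    simp only [hexp]
    rw [cubeDiff_sum_mul _ h _ (fun i (y : ℤ) => (y : ℝ) ^ i)]
    have hval : ∀ i ∈ Finset.range j, ((-(a : ℝ)) ^ (j - i) * (j.choose i)) *
        cubeDiff h (fun y : ℤ => (y : ℝ) ^ i) x = if i = k then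
          (-(a : ℝ)) ^ (j - i) * (j.choose i) * ((-1) ^ k * k.factorial * ∏ i, (h i : ℝ)) else 0 := by
      intro i hi
      rw [ih (by have := Finset.mem_range.1 hi; omega)]
      split_ifs <;> simp
    rw [Finset.sum_congr rfl hval, Finset.sum_ite_eq']
    by_cases hjk : j = k + 1
    · subst hjk
      simp only [Finset.mem_range, Nat.lt_succ_self, if_true, Nat.choose_succ_self_right,
        Fin.prod_univ_succ, Fin.cons_zero, Fin.cons_succ, Nat.factorial_succ]
      rw [Nat.add_sub_cancel_left]
      push_cast
      ring
    · rw [if_neg (by rw [Finset.mem_range]; omega), if_neg hjk]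

/-- Moving the base point by at most `L` adds one more step to the cube, so it costs one `(k +
1)`-st difference; `m` such moves reach `B`. -/
theorem abs_cubeDiff_sub_le {k : ℕ} {A B L : ℤ} (hL : 0 < L) {δ : ℝ} {ψ : ℤ → ℝ}
    (hψ : ∀ h : Fin (k + 1) → ℤ, (∀ i, 0 ≤ h i ∧ h i ≤ L) → ∀ x, x ≤ B → A ≤ x - ∑ i, h i →
      |cubeDiff h ψ x| ≤ δ)
    (h : Fin k → ℤ) (hh : ∀ i, 0 ≤ h i ∧ h i ≤ L) (m : ℕ) (x : ℤ) (hx : x ≤ B)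
    (hA : A ≤ x - ∑ i, h i) (hm : B - x ≤ m * L) :
    |cubeDiff h ψ x - cubeDiff h ψ B| ≤ m * δ := by
  have hcons : ∀ s, 0 ≤ s → s ≤ L → ∀ i, 0 ≤ (Fin.cons s h : Fin (k + 1) → ℤ) i ∧
      (Fin.cons s h : Fin (k + 1) → ℤ) i ≤ L := fun s h1 h2 i => by
    refine Fin.cases ?_ (fun i => ?_) i
    · exact ⟨h1, h2⟩
    · exact hh i
  induction m generalizing x with
  | zero =>
    have : x = B := by simp at hm; omega
    simp [this]
  | succ m ih =>
    push_cast at hm ⊢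
    have hδ : 0 ≤ δ := (abs_nonneg _).trans (hψ _ (hcons 0 le_rfl hL.le) x hx
      (by rw [Fin.sum_cons]; omega))
    by_cases hxB : x + L ≤ B
    · have b1 := ih (x + L) hxB (by omega) (by linarith)
      have b2 := hψ _ (hcons L hL.le le_rfl) (x + L) hxB (by rw [Fin.sum_cons]; omega)
      rw [cubeDiff_cons, add_sub_cancel_right] at b2
      calc _ = |(cubeDiff h ψ x - cubeDiff h ψ (x + L)) + (cubeDiff h ψ (x + L) - cubeDiff h ψ B)| := by
            rw [sub_add_sub_cancel]
        _ ≤ _ := (abs_add_le _ _).trans (by linarith)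
    · have b2 := hψ _ (hcons (B - x) (by omega) (by omega)) B le_rfl
        (by rw [Fin.sum_cons]; omega)
      rw [cubeDiff_cons, sub_sub_cancel] at b2
      nlinarith [mul_nonneg (Nat.cast_nonneg (α := ℝ) m) hδ]

/-- A discrete form of Whitney's theorem: a function with small `k`-th differences on an interval is
uniformly close to a polynomial of degree less than `k`. -/
theorem exists_polynomial_near (k K : ℕ) : ∃ C : ℝ, 0 ≤ C ∧ ∀ (A B L : ℤ) (δ : ℝ) (ψ : ℤ → ℝ),
    0 < L → k * L ≤ B - A → B - A ≤ K * L →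
    (∀ h : Fin k → ℤ, (∀ i, 0 ≤ h i ∧ h i ≤ L) → ∀ x, x ≤ B → A ≤ x - ∑ i, h i →
      |cubeDiff h ψ x| ≤ δ) →
    ∃ p : ℤ → ℝ, (∀ (h : Fin k → ℤ) (x : ℤ), cubeDiff h p x = 0) ∧
      ∀ x, A ≤ x → x ≤ B → |ψ x - p x| ≤ C * δ := by
  induction k with
  | zero =>
    refine ⟨1, zero_le_one, fun A B L δ ψ _ _ _ hψ => ⟨0, fun h x => by simp [cubeDiff], ?_⟩⟩
    intro x hA hB
    simpa [cubeDiff_zero] using hψ (fun _ => 0) (fun i => i.elim0) x hB (by simpa using hA)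
  | succ k ih =>
    obtain ⟨C, hC, H⟩ := ih
    refine ⟨C * (K + 3 * k), by positivity, fun A B L δ ψ hL hk hK hψ => ?_⟩
    push_cast at hk
    have hL' : (L : ℝ) ≠ 0 := by exact_mod_cast hL.ne'
    have hsumle : ∀ h : Fin k → ℤ, (∀ i, 0 ≤ h i ∧ h i ≤ L) → ∑ i, h i ≤ k * L := fun h hh => by
      simpa using Finset.sum_le_sum fun i (_ : i ∈ Finset.univ) => (hh i).2
    -- The additivity defect of `h ↦ cubeDiff h ψ B` in coordinate `i` is itself a `(k + 1)`-st
    -- difference, with steps `s` and `s'` in two directions.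
    have hmulti : ∀ h : Fin k → ℤ, (∀ i, 0 ≤ h i ∧ h i ≤ L) →
        |cubeDiff h ψ B - (∏ i, (h i : ℝ) / L) * cubeDiff (fun _ : Fin k => L) ψ B|
          ≤ 3 * k * δ := by
      refine abs_sub_multilinear_le (T := fun h => cubeDiff h ψ B) hL ?_
      intro h hh i s s' hs hs' hss
      have hbox := update_mem_box hh i (s := s') ⟨hs', by omega⟩
      have := hψ (Fin.cons s (Function.update h i s')) (fun j => by
        refine Fin.cases ?_ (fun j => ?_) j
        · exact ⟨hs, by simp only [Fin.cons_zero]; omega⟩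
        · simpa using hbox j) B le_rfl (by
          have h1 := hsumle _ (update_mem_box hh i (s := s + s') ⟨by omega, hss⟩)
          rw [sum_update] at h1
          rw [Fin.sum_cons, sum_update]
          linarith)
      rw [cubeDiff_cons] at this
      rw [cubeDiff_update]
      convert this using 2
      ring
    -- With this coefficient, the `k`-th difference of `c * y ^ k` is exactly the multilinear
    -- approximation of `hmulti`.
    set c : ℝ := cubeDiff (fun _ : Fin k => L) ψ B / ((-1) ^ k * k.factorial * L ^ k) with hc
    have hfac : ((-1 : ℝ) ^ k * k.factorial) ≠ 0 :=
      mul_ne_zero (pow_ne_zero _ (by norm_num)) (by exact_mod_cast k.factorial_ne_zero)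
    have hmon : ∀ (h : Fin k → ℤ) (x : ℤ), cubeDiff h (fun y : ℤ => c * (y : ℝ) ^ k) x
        = (∏ i, (h i : ℝ) / L) * cubeDiff (fun _ : Fin k => L) ψ B := by
      intro h x
      have := cubeDiff_sum_mul {()} h (fun _ => c) (fun _ (y : ℤ) => (y : ℝ) ^ k) x
      simp only [Finset.sum_singleton] at this
      rw [this, cubeDiff_pow le_rfl, if_pos rfl, hc, Finset.prod_div_distrib]
      simp only [Finset.prod_const, Finset.card_univ, Fintype.card_fin]
      have hLk : (L : ℝ) ^ k ≠ 0 := pow_ne_zero _ hL'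
      field_simp
    obtain ⟨p, hp, hpψ⟩ := H A B L ((K + 3 * k) * δ) (fun y => ψ y - c * (y : ℝ) ^ k) hL
      (by linarith) hK (by
        intro h hh x hx hA
        have b1 := abs_cubeDiff_sub_le hL hψ h hh K x hx hA (by
          have := Finset.sum_nonneg fun i (_ : i ∈ Finset.univ) => (hh i).1
          omega)
        have b2 := hmulti h hh
        rw [cubeDiff_sub, hmon]
        calc _ = |(cubeDiff h ψ x - cubeDiff h ψ B) + (cubeDiff h ψ B -
              (∏ i, (h i : ℝ) / L) * cubeDiff (fun _ : Fin k => L) ψ B)| := by rw [sub_add_sub_cancel]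
          _ ≤ _ := (abs_add_le _ _).trans (by linarith))
    refine ⟨fun y => p y + c * (y : ℝ) ^ k, fun h x => ?_, fun x hA hB => ?_⟩
    · obtain ⟨a, h, rfl⟩ : ∃ (a : ℤ) (h' : Fin k → ℤ), h = Fin.cons a h' :=
        ⟨h 0, Fin.tail h, (Fin.cons_self_tail h).symm⟩
      rw [cubeDiff_add, cubeDiff_cons, cubeDiff_cons, hp, hp, hmon, hmon]
      ring
    · have := hpψ x hA hB
      rw [mul_assoc]
      convert this using 2
      ring

/-- A circle-valued function on an interval with small `k`-th differences is uniformly close to a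
polynomial of degree at most `k - 1`. -/
theorem exists_circle_polynomial_near (k : ℕ) (hk : 1 ≤ k) : ∃ C : ℝ, 0 ≤ C ∧
    ∀ (A B : ℤ) (δ : ℝ) (φ : ℤ → UnitAddCircle), k ≤ B - A → 3 * δ < 1 →
    (∀ h : Fin k → ℤ, (∀ i, 0 ≤ h i) → ∀ x, x ≤ B → A ≤ x - ∑ i, h i →
      ‖cubeDiff h φ x‖ ≤ δ) →
    ∃ P : ℤ → UnitAddCircle, IsPolynomialOfDegreeLE ((k : ℤ) - 1) P ∧
      ∀ x, A ≤ x → x ≤ B → ‖φ x - P x‖ ≤ C * δ := by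
  obtain ⟨C, hC, H⟩ := exists_polynomial_near k (2 * k)
  refine ⟨C, hC, fun A B δ φ hAB hδ hφ => ?_⟩
  obtain ⟨ψ, hψ, hunit⟩ := exists_lift_unit_steps k φ
  have hk' : (0 : ℤ) < k := by exact_mod_cast hk
  have hdiv := Int.mul_ediv_add_emod (B - A) k
  have hmod := Int.emod_lt_of_pos (B - A) hk'
  have hmod0 := Int.emod_nonneg (B - A) hk'.ne'
  have hL : 0 < (B - A) / k := Int.le_ediv_of_mul_le hk' (by simpa using hAB)
  -- Integer division discards less than `k ≤ k * L`, where `L = (B - A) / k`. This is why the ratio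
  -- bound is `2 * k`.
  obtain ⟨p, hp, hpψ⟩ := H A B ((B - A) / k) δ ψ hL (by linarith) (by
      push_cast; nlinarith) (fun h hh x hx hA =>
    abs_cubeDiff_lift_le hδ hψ hunit hφ h (fun i => (hh i).1) x hx hA)
  refine ⟨fun x => (p x : UnitAddCircle), (isPolynomialOfDegreeLE_iff _).2 fun h x => ?_,
    fun x hA hB => ?_⟩
  · rw [cubeDiff_coe, hp]; simp
  · rw [← hψ, ← AddCircle.coe_sub]
    refine le_trans ?_ (hpψ x hA hB)
    exact QuotientAddGroup.norm_mk_le_norm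

/-! ### Cubes in an interval and counting. -/

/-- The `k`-dimensional cubes (base point and steps) whose vertices lie in `[A, B]`. -/
def cubes (k : ℕ) (A B : ℤ) : Finset (ℤ × (Fin k → ℤ)) :=
  (Finset.Icc A B ×ˢ Fintype.piFinset fun _ => Finset.Icc (A - B) (B - A)).filter
    fun c => ∀ ω, c.1 - dot ω c.2 ∈ Finset.Icc A B

theorem mem_cubes {k : ℕ} {A B : ℤ} {c : ℤ × (Fin k → ℤ)} :
    c ∈ cubes k A B ↔ ∀ ω, A ≤ c.1 - dot ω c.2 ∧ c.1 - dot ω c.2 ≤ B := by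
  simp only [cubes, Finset.mem_filter, Finset.mem_product, Fintype.mem_piFinset, Finset.mem_Icc,
    and_iff_right_iff_imp]
  intro h
  have h0 := h fun _ => false
  rw [dot_false, sub_zero] at h0
  refine ⟨h0, fun i => ?_⟩
  have hi := h fun j => decide (j = i)
  rw [dot_single] at hi
  omega

/-- The box of steps bounded by `L`. -/
def box (ι : Type*) [Fintype ι] [DecidableEq ι] (L : ℕ) : Finset (ι → ℤ) :=
  Fintype.piFinset fun _ => Finset.Icc (-(L : ℤ)) L

theorem mem_box {ι : Type*} [Fintype ι] [DecidableEq ι] {L : ℕ} {u : ι → ℤ} :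
    u ∈ box ι L ↔ ∀ i, |u i| ≤ L := by
  simp [box, abs_le]

theorem card_box (ι : Type*) [Fintype ι] [DecidableEq ι] (L : ℕ) :
    (box ι L).card = (2 * L + 1) ^ Fintype.card ι := by
  rw [box, Fintype.card_piFinset, Finset.prod_const, Finset.card_univ, Int.card_Icc]
  congr 1
  omega

theorem card_box_ne {k : ℕ} (i : Fin k) (L : ℕ) :
    (box {j // j ≠ i} L).card = (2 * L + 1) ^ (k - 1) := by
  rw [card_box]
  simp [Fintype.card_subtype_compl]

theorem abs_dot_le {k : ℕ} {L : ℕ} {h : Fin k → ℤ} (hh : ∀ i, |h i| ≤ L) (ω : Fin k → Bool) :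
    |dot ω h| ≤ k * L := by
  refine (Finset.abs_sum_le_sum_abs _ _).trans ?_
  have : ∀ i ∈ (Finset.univ : Finset (Fin k)), |if ω i then h i else 0| ≤ (L : ℤ) := by
    intro i _
    split_ifs
    · exact hh i
    · simp
  simpa using Finset.sum_le_sum this

/-- On each fibre of `p` the map `q` is injective into `Q`, so every value is repeated at most
`Q.card` times. -/
theorem sum_comp_le {α β γ : Type*} [DecidableEq β] [DecidableEq γ] {S : Finset α}
    {T : Finset β} {Q : Finset γ} (p : α → β) (q : α → γ) (hp : ∀ a ∈ S, p a ∈ T)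
    (hq : ∀ a ∈ S, q a ∈ Q)
    (hinj : ∀ a ∈ S, ∀ b ∈ S, p a = p b → q a = q b → a = b) {W : β → ℝ} (hW : ∀ b, 0 ≤ W b) :
    ∑ a ∈ S, W (p a) ≤ Q.card * ∑ b ∈ T, W b := by
  calc ∑ a ∈ S, W (p a) = ∑ c ∈ S.image fun a => (p a, q a), W c.1 := by
        rw [Finset.sum_image]
        intro a ha b hb hab
        exact hinj a ha b hb (Prod.ext_iff.1 hab).1 (Prod.ext_iff.1 hab).2
    _ ≤ ∑ c ∈ T ×ˢ Q, W c.1 := by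
        refine Finset.sum_le_sum_of_subset_of_nonneg ?_ fun c _ _ => hW _
        intro c hc
        obtain ⟨a, ha, rfl⟩ := Finset.mem_image.1 hc
        exact Finset.mem_product.2 ⟨hp a ha, hq a ha⟩
    _ = _ := by
        rw [Finset.sum_product]
        simp [Finset.mul_sum]

theorem mem_cubes_of_abs_le {k : ℕ} {A B x : ℤ} {h : Fin k → ℤ} {L : ℕ} (hh : ∀ i, |h i| ≤ L)
    (hA : A + k * L ≤ x) (hB : x ≤ B - k * L) : (x, h) ∈ cubes k A B := by
  rw [mem_cubes]
  intro ω
  have := abs_le.1 (abs_dot_le hh ω)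
  dsimp only
  omega

/-- Summing a nonnegative function over small cubes based well inside an interval. -/
theorem sum_inner_le {k : ℕ} {A B : ℤ} {L : ℕ} {m : ℤ} (hm : k * L ≤ m)
    {W : ℤ × (Fin k → ℤ) → ℝ} (hW : ∀ c, 0 ≤ W c) :
    ∑ x ∈ Finset.Icc (A + m) (B - m), ∑ u ∈ box (Fin k) L, W (x, u) ≤ ∑ c ∈ cubes k A B, W c := by
  rw [← Finset.sum_product']
  refine Finset.sum_le_sum_of_subset_of_nonneg ?_ fun c _ _ => hW _
  rintro ⟨x, u⟩ hc
  rw [Finset.mem_product, Finset.mem_Icc, mem_box] at hc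
  exact mem_cubes_of_abs_le hc.2 (by linarith [hc.1.1]) (by linarith [hc.1.2])

/-! ### Self-correction: from small differences on average to small differences everywhere. -/

theorem sum_piecewise_le {k : ℕ} {E : Type*} [SeminormedAddCommGroup E] {L : ℕ}
    (F : (Fin k → ℤ) → E) {M : ℝ}
    (hF : ∀ i, ∑ c ∈ box (Fin k) L ×ˢ box (Fin k) L,
      ‖F (Function.update c.1 i (c.2 i)) - F c.1‖ ≤ M) (s : Finset (Fin k)) :
    ∑ c ∈ box (Fin k) L ×ˢ box (Fin k) L, ‖F (s.piecewise c.2 c.1) - F c.1‖ ≤ s.card * M := by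
  induction s using Finset.induction_on with
  | empty => simp
  | insert j s hj ih =>
    -- Exchanging the coordinates in `s` between the two vectors is an involution of the double box,
    -- so each change of one coordinate costs the same as the first.
    have hswap : ∑ c ∈ box (Fin k) L ×ˢ box (Fin k) L,
        ‖F (Function.update (s.piecewise c.2 c.1) j (c.2 j)) - F (s.piecewise c.2 c.1)‖
        = ∑ c ∈ box (Fin k) L ×ˢ box (Fin k) L,
          ‖F (Function.update c.1 j (c.2 j)) - F c.1‖ := by
      have hmem : ∀ c ∈ box (Fin k) L ×ˢ box (Fin k) L,
          (s.piecewise c.2 c.1, s.piecewise c.1 c.2) ∈ box (Fin k) L ×ˢ box (Fin k) L := by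
        intro c hc
        rw [Finset.mem_product, mem_box, mem_box] at hc ⊢
        constructor <;> intro i <;> by_cases hi : i ∈ s <;> simp [hi, hc.1 i, hc.2 i]
      have hinv : ∀ c : (Fin k → ℤ) × (Fin k → ℤ),
          (s.piecewise (s.piecewise c.1 c.2) (s.piecewise c.2 c.1),
            s.piecewise (s.piecewise c.2 c.1) (s.piecewise c.1 c.2)) = c := by
        intro c
        ext i <;> by_cases hi : i ∈ s <;> simp [hi]
      refine Finset.sum_nbij' (fun c => (s.piecewise c.2 c.1, s.piecewise c.1 c.2))
        (fun c => (s.piecewise c.2 c.1, s.piecewise c.1 c.2)) hmem hmem (fun c _ => hinv c)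
        (fun c _ => hinv c) fun c _ => ?_
      simp [hj]
    rw [Finset.card_insert_of_notMem hj]
    push_cast
    calc _ ≤ ∑ c ∈ box (Fin k) L ×ˢ box (Fin k) L,
          (‖F (Function.update (s.piecewise c.2 c.1) j (c.2 j)) - F (s.piecewise c.2 c.1)‖
            + ‖F (s.piecewise c.2 c.1) - F c.1‖) := by
          refine Finset.sum_le_sum fun c _ => ?_
          rw [Finset.piecewise_insert]
          exact norm_sub_le_norm_sub_add_norm_sub _ _ _
      _ ≤ _ := by
          rw [Finset.sum_add_distrib, hswap]
          linarith [hF j]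

section
variable {k : ℕ} {E : Type*} [SeminormedAddCommGroup E]

/-- By the cocycle identity, exchanging one step changes the alternating sum by that of another
cube, based at `x - c.2 i`. This cube forgets only the entries of `c.2` other than the `i`-th,
whence the power `k - 1`. Its steps are at most `2 * L` and its base moves by at most `L`, so the
margin is `(2 * k + 1) * L`. -/
theorem sum_cubeDiff_update_le {A B x : ℤ} {L : ℕ} {m : ℤ} (hm : (2 * k + 1) * L ≤ m)
    (φ : ℤ → E) (hA : A + m ≤ x) (hB : x ≤ B - m) (i : Fin k) :
    ∑ c ∈ box (Fin k) L ×ˢ box (Fin k) L,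
      ‖cubeDiff (Function.update c.1 i (c.2 i)) φ x - cubeDiff c.1 φ x‖
      ≤ (2 * L + 1) ^ (k - 1) * ∑ c ∈ cubes k A B, ‖cubeDiff c.2 φ c.1‖ := by
  have hid : ∀ c : (Fin k → ℤ) × (Fin k → ℤ),
      ‖cubeDiff (Function.update c.1 i (c.2 i)) φ x - cubeDiff c.1 φ x‖
      = ‖cubeDiff (Function.update c.1 i (c.1 i - c.2 i)) φ (x - c.2 i)‖ := by
    intro c
    have := cubeDiff_update c.1 i (c.2 i) (c.1 i - c.2 i) φ x
    rw [add_sub_cancel, Function.update_eq_self] at this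
    rw [this, sub_add_cancel_left, norm_neg]
  simp only [hid]
  have := sum_comp_le (S := box (Fin k) L ×ˢ box (Fin k) L) (T := cubes k A B)
    (Q := box {j // j ≠ i} L)
    (fun c => (x - c.2 i, Function.update c.1 i (c.1 i - c.2 i))) (fun c j => c.2 j)
    (by
      intro c hc
      rw [Finset.mem_product, mem_box, mem_box] at hc
      have h2 := abs_le.1 (hc.2 i)
      refine mem_cubes_of_abs_le (L := 2 * L) (fun j => ?_) ?_ ?_
      · push_cast
        rcases eq_or_ne j i with rfl | hj
        · rw [Function.update_self]
          exact (abs_sub _ _).trans (by linarith [hc.1 j, hc.2 j])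
        · rw [Function.update_of_ne hj]
          linarith [hc.1 j, abs_nonneg (c.1 j)]
      · push_cast; linarith
      · push_cast; linarith)
    (by
      intro c hc
      rw [Finset.mem_product, mem_box, mem_box] at hc
      rw [mem_box]
      exact fun j => hc.2 j)
    (by
      intro c _ d _ h1 h2
      rw [Prod.mk.injEq] at h1
      have hi : c.2 i = d.2 i := by linarith [h1.1]
      ext j
      · rcases eq_or_ne j i with rfl | hj
        · have := congrFun h1.2 j
          simp only [Function.update_self] at this
          linarith
        · simpa [hj] using congrFun h1.2 j
      · rcases eq_or_ne j i with rfl | hj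
        · exact hi
        · exact congrFun h2 ⟨j, hj⟩)
    (W := fun c => ‖cubeDiff c.2 φ c.1‖) (fun _ => norm_nonneg _)
  rw [card_box_ne] at this
  exact_mod_cast this

theorem sgn_smul_sgn_smul (ω : Fin k → Bool) (y : E) : sgn ω • sgn ω • y = y := by
  rw [smul_smul, sgn_mul_self, one_smul]

/-- The value at `x` predicted by the other vertices of a cube based at `x`. -/
def predict (φ : ℤ → E) (x : ℤ) (u : Fin k → ℤ) : E :=
  φ x - sgn (fun _ : Fin k => false) • cubeDiff u φ x

theorem norm_sub_predict (φ : ℤ → E) (x : ℤ) (u : Fin k → ℤ) :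
    ‖φ x - predict φ x u‖ = ‖cubeDiff u φ x‖ := by
  rw [predict, sub_sub_cancel, norm_sgn_smul]

theorem exists_predict_near (hk : 1 ≤ k) {A B x : ℤ} {L : ℕ} {m : ℤ} (hm : (2 * k + 1) * L ≤ m)
    (φ : ℤ → E) (hA : A + m ≤ x) (hB : x ≤ B - m) :
    ∃ y : E, ∑ u ∈ box (Fin k) L, ‖predict φ x u - y‖
      ≤ k / (2 * L + 1) * ∑ c ∈ cubes k A B, ‖cubeDiff c.2 φ c.1‖ := by
  set S := ∑ c ∈ cubes k A B, ‖cubeDiff c.2 φ c.1‖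
  have h1 := sum_piecewise_le (fun u => cubeDiff u φ x)
    (fun i => sum_cubeDiff_update_le hm φ hA hB i) Finset.univ
  simp only [Finset.piecewise_univ, Finset.card_univ, Fintype.card_fin] at h1
  rw [Finset.sum_product_right] at h1
  have hpos : (0 : ℝ) < 2 * L + 1 := by positivity
  have hne : (box (Fin k) L).Nonempty := ⟨0, mem_box.2 fun i => by simp⟩
  -- Pigeonhole over `v`: some cube gives a prediction that agrees with the others at least as well
  -- as average.
  obtain ⟨v, -, hv⟩ := Finset.exists_le_of_sum_le hne (f := fun v =>
      ∑ u ∈ box (Fin k) L, ‖cubeDiff v φ x - cubeDiff u φ x‖) (g := fun _ => k / (2 * L + 1) * S)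
    (by
      refine h1.trans (le_of_eq ?_)
      rw [Finset.sum_const, card_box, Fintype.card_fin, nsmul_eq_mul]
      obtain ⟨j, rfl⟩ : ∃ j, k = j + 1 := ⟨k - 1, by omega⟩
      rw [Nat.add_sub_cancel]
      push_cast
      field_simp
      simp only [S]
      ring)
  refine ⟨predict φ x v, (le_of_eq ?_).trans hv⟩
  refine Finset.sum_congr rfl fun u _ => ?_
  rw [predict, predict, sub_sub_sub_cancel_left, ← smul_sub, norm_sgn_smul]

theorem dot_add_const (η : Fin k → Bool) (a : Fin k → ℤ) (c : ℤ) :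
    dot η (fun i => a i + c) = dot η a + dot η (fun _ => 1) * c := by
  simp only [dot, Finset.sum_mul, ← Finset.sum_add_distrib]
  exact Finset.sum_congr rfl fun i _ => by split_ifs <;> simp

theorem dot_add_mul (ω : Fin k → Bool) (t b : Fin k → ℤ) (r : ℤ) :
    dot ω (fun i => t i + r * b i) = dot ω t + r * dot ω b := by
  simp only [dot, Finset.mul_sum, ← Finset.sum_add_distrib]
  exact Finset.sum_congr rfl fun i _ => by split_ifs <;> simp

/-- Predicting every vertex of a cube from a cube of cubes. -/
theorem sum_sgn_cubeDiff_eq (φ : ℤ → E) (x : ℤ) (t a b : Fin k → ℤ) :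
    ∑ ω : Fin k → Bool, sgn ω • cubeDiff (fun i => a i + dot ω b) φ (x - dot ω t)
      = ∑ η : Fin k → Bool, sgn η •
        cubeDiff (fun i => t i + dot η (fun _ => 1) * b i) φ (x - dot η a) := by
  simp only [cubeDiff, Finset.smul_sum]
  rw [Finset.sum_comm]
  refine Finset.sum_congr rfl fun η _ => Finset.sum_congr rfl fun ω _ => ?_
  rw [smul_comm, dot_add_const, dot_add_mul]
  congr 3
  ring

/-- Take the alternating sum of the predictions at the vertices of `t`. The contribution of `φ`
itself cancels the `η = 0` term of `sum_sgn_cubeDiff_eq`. What remains involves only cubes that vary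
with `a` and `b`, so it can be averaged even though `x` and `t` are fixed. -/
theorem norm_cubeDiff_le_sum (φ g : ℤ → E) (x : ℤ) (t a b : Fin k → ℤ) :
    ‖cubeDiff t g x‖ ≤
      ∑ ω : Fin k → Bool, ‖predict φ (x - dot ω t) (fun i => a i + dot ω b) - g (x - dot ω t)‖
      + ∑ η ∈ Finset.univ.erase (fun _ : Fin k => false),
        ‖cubeDiff (fun i => t i + dot η (fun _ => 1) * b i) φ (x - dot η a)‖ := by
  have h1 : ∑ ω : Fin k → Bool, sgn ω • predict φ (x - dot ω t) (fun i => a i + dot ω b)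
      = - (sgn (fun _ : Fin k => false) • ∑ η ∈ Finset.univ.erase (fun _ : Fin k => false),
        sgn η • cubeDiff (fun i => t i + dot η (fun _ => 1) * b i) φ (x - dot η a)) := by
    have h2 := (sum_sgn_cubeDiff_eq φ x t a b).symm
    rw [← Finset.add_sum_erase _ _ (Finset.mem_univ (fun _ : Fin k => false))] at h2
    simp only [dot_false, zero_mul, add_zero, sub_zero] at h2
    simp only [predict, smul_sub, Finset.sum_sub_distrib]
    have h3 : ∑ ω : Fin k → Bool, sgn ω • sgn (fun _ : Fin k => false) •
        cubeDiff (fun i => a i + dot ω b) φ (x - dot ω t)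
        = sgn (fun _ : Fin k => false) • ∑ ω : Fin k → Bool, sgn ω •
          cubeDiff (fun i => a i + dot ω b) φ (x - dot ω t) := by
      rw [Finset.smul_sum]
      exact Finset.sum_congr rfl fun ω _ => smul_comm _ _ _
    rw [h3, ← h2, smul_add, sgn_smul_sgn_smul]
    change cubeDiff t φ x - _ = _
    abel
  have h4 : cubeDiff t g x = ∑ ω : Fin k → Bool,
        sgn ω • predict φ (x - dot ω t) (fun i => a i + dot ω b)
      - ∑ ω : Fin k → Bool, sgn ω • (predict φ (x - dot ω t) (fun i => a i + dot ω b)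
        - g (x - dot ω t)) := by
    rw [← Finset.sum_sub_distrib, cubeDiff]
    exact Finset.sum_congr rfl fun ω _ => by rw [← smul_sub, sub_sub_cancel]
  rw [h4, h1]
  refine (norm_sub_le _ _).trans ?_
  rw [norm_neg, norm_sgn_smul, add_comm]
  refine add_le_add ((norm_sum_le _ _).trans (le_of_eq ?_)) ((norm_sum_le _ _).trans (le_of_eq ?_))
  · exact Finset.sum_congr rfl fun ω _ => norm_sgn_smul _ _
  · exact Finset.sum_congr rfl fun ω _ => norm_sgn_smul _ _

theorem one_le_dot_one {η : Fin k → Bool} {i : Fin k} (hi : η i = true) :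
    (1 : ℤ) ≤ dot η fun _ => 1 := by
  have : (if η i then (1 : ℤ) else 0) ≤ dot η fun _ => 1 :=
    Finset.single_le_sum (f := fun i => if η i then (1 : ℤ) else 0)
      (fun j _ => by positivity) (Finset.mem_univ i)
  simpa [hi] using this

theorem dot_eq_of_ne {η : Fin k → Bool} {i : Fin k} (hi : η i = true) {a a' : Fin k → ℤ}
    (hne : ∀ j, j ≠ i → a j = a' j) (h : dot η a = dot η a') : a = a' := by
  have h1 : ∀ c : Fin k → ℤ, dot η c = c i + ∑ j ∈ Finset.univ.erase i, if η j then c j else 0 := by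
    intro c
    rw [dot, ← Finset.add_sum_erase _ _ (Finset.mem_univ i), if_pos hi]
  rw [h1, h1, Finset.sum_congr rfl fun j hj => by rw [hne j (Finset.ne_of_mem_erase hj)]] at h
  funext j
  rcases eq_or_ne j i with rfl | hj
  · exact add_right_cancel h
  · exact hne j hj

/-- The factor `dot η 1` is nonzero, so the steps of the new cube determine `c.2`. Its base point
determines the `i`-th entry of `c.1` from the others, leaving `k - 1` free coordinates. -/
theorem sum_cubeDiff_shift_le {A B x : ℤ} {l : ℕ} {m : ℤ} (hm : k * ((k + 1) * l) ≤ m)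
    (φ : ℤ → E) {t : Fin k → ℤ} (ht : (x, t) ∈ cubes k (A + m) (B - m)) {η : Fin k → Bool}
    {i : Fin k} (hi : η i = true) :
    ∑ c ∈ box (Fin k) l ×ˢ box (Fin k) l,
      ‖cubeDiff (fun i => t i + dot η (fun _ => 1) * c.2 i) φ (x - dot η c.1)‖
      ≤ (2 * l + 1) ^ (k - 1) * ∑ c ∈ cubes k A B, ‖cubeDiff c.2 φ c.1‖ := by
  have hr1 := one_le_dot_one hi
  have hrk : dot η (fun _ => (1 : ℤ)) ≤ k := by
    have := (abs_le.1 (abs_dot_le (L := 1) (h := fun _ : Fin k => (1 : ℤ)) (by simp) η)).2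
    simpa using this
  have := sum_comp_le (S := box (Fin k) l ×ˢ box (Fin k) l) (T := cubes k A B)
    (Q := box {j // j ≠ i} l)
    (fun c => (x - dot η c.1, fun i => t i + dot η (fun _ => 1) * c.2 i)) (fun c j => c.1 j)
    (by
      intro c hc
      rw [Finset.mem_product, mem_box, mem_box] at hc
      rw [mem_cubes] at ht ⊢
      intro ω
      have hω := ht ω
      dsimp only at hω ⊢
      rw [dot_add_mul]
      have b1 := abs_dot_le hc.1 η
      have b2 := abs_dot_le hc.2 ω
      have b3 : |dot η (fun _ => (1 : ℤ)) * dot ω c.2| ≤ k * (k * l) := by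
        rw [abs_mul, abs_of_nonneg (by omega : (0 : ℤ) ≤ dot η fun _ => 1)]
        exact mul_le_mul hrk b2 (abs_nonneg _) (by positivity)
      rw [abs_le] at b1 b3
      constructor <;> nlinarith [b1.1, b1.2, b3.1, b3.2, hω.1, hω.2])
    (by
      intro c hc
      rw [Finset.mem_product, mem_box, mem_box] at hc
      rw [mem_box]
      exact fun j => hc.1 j)
    (by
      intro c _ d _ h1 h2
      rw [Prod.mk.injEq] at h1
      refine Prod.ext (dot_eq_of_ne hi (fun j hj => congrFun h2 ⟨j, hj⟩) (by linarith [h1.1])) ?_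
      funext j
      have := congrFun h1.2 j
      exact mul_left_cancel₀ (by omega : dot η (fun _ => (1 : ℤ)) ≠ 0) (by linarith))
    (W := fun c => ‖cubeDiff c.2 φ c.1‖) (fun _ => norm_nonneg _)
  rw [card_box_ne] at this
  exact_mod_cast this

/-- A function whose differences over the cubes of an interval are small on average can be corrected
so that they are all small well inside the interval. -/
theorem exists_correction (hk : 1 ≤ k) {A B : ℤ} {l : ℕ} {m : ℤ}
    (hm : (2 * k + 1) * ((k + 1) * l) ≤ m) (φ : ℤ → E) {S : ℝ}
    (hS : ∑ c ∈ cubes k A B, ‖cubeDiff c.2 φ c.1‖ ≤ S) :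
    ∃ g : ℤ → E,
      (2 * l + 1) ^ k * ∑ x ∈ Finset.Icc (A + m) (B - m), ‖φ x - g x‖
        ≤ S + (Finset.Icc (A + m) (B - m)).card * (k / (2 * l + 1) * S) ∧
      ∀ c ∈ cubes k (A + m) (B - m),
        (2 * l + 1) ^ (k + 1) * ‖cubeDiff c.2 g c.1‖ ≤ 2 ^ k * (k + 1) * S := by
  -- The steps `a i + dot ω b`, with entries of `a` and `b` bounded by `l`, are bounded by `(k + 1)
  -- * l`.
  set L : ℕ := (k + 1) * l with hL
  have hmL : (2 * (k : ℤ) + 1) * L ≤ m := by rw [hL]; push_cast; exact hm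
  have hlL : (l : ℝ) ≤ L := by
    rw [hL]; push_cast; nlinarith [Nat.cast_nonneg (α := ℝ) k, Nat.cast_nonneg (α := ℝ) l]
  have hS0 : 0 ≤ S := (Finset.sum_nonneg fun _ _ => norm_nonneg _).trans hS
  have hpos : (0 : ℝ) < 2 * l + 1 := by positivity
  have hkL : (k : ℝ) / (2 * L + 1) ≤ k / (2 * l + 1) := by gcongr
  have hex : ∀ x, ∃ y : E, A + m ≤ x → x ≤ B - m →
      ∑ u ∈ box (Fin k) L, ‖predict φ x u - y‖ ≤ k / (2 * l + 1) * S := by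
    intro x
    by_cases hx : A + m ≤ x ∧ x ≤ B - m
    · obtain ⟨y, hy⟩ := exists_predict_near hk hmL φ hx.1 hx.2
      exact ⟨y, fun _ _ => hy.trans (mul_le_mul hkL hS
        (Finset.sum_nonneg fun _ _ => norm_nonneg _) (by positivity))⟩
    · exact ⟨0, fun h1 h2 => absurd ⟨h1, h2⟩ hx⟩
  choose g hg using hex
  refine ⟨g, ?_, ?_⟩
  · calc (2 * (l : ℝ) + 1) ^ k * ∑ x ∈ Finset.Icc (A + m) (B - m), ‖φ x - g x‖
        ≤ (2 * (L : ℝ) + 1) ^ k * ∑ x ∈ Finset.Icc (A + m) (B - m), ‖φ x - g x‖ := by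
          have := Finset.sum_nonneg fun x (_ : x ∈ Finset.Icc (A + m) (B - m)) =>
            norm_nonneg (φ x - g x)
          gcongr
      _ = ∑ x ∈ Finset.Icc (A + m) (B - m), ∑ u ∈ box (Fin k) L, ‖φ x - g x‖ := by
          rw [Finset.mul_sum]
          refine Finset.sum_congr rfl fun x _ => ?_
          rw [Finset.sum_const, card_box, Fintype.card_fin, nsmul_eq_mul]
          push_cast
          rfl
      _ ≤ ∑ x ∈ Finset.Icc (A + m) (B - m), ∑ u ∈ box (Fin k) L,
            (‖cubeDiff u φ x‖ + ‖predict φ x u - g x‖) := by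
          refine Finset.sum_le_sum fun x _ => Finset.sum_le_sum fun u _ => ?_
          rw [← norm_sub_predict]
          exact norm_sub_le_norm_sub_add_norm_sub _ _ _
      _ ≤ _ := by
          simp only [Finset.sum_add_distrib]
          refine add_le_add ((sum_inner_le (W := fun c => ‖cubeDiff c.2 φ c.1‖) (by
            nlinarith [Nat.cast_nonneg (α := ℤ) k, Nat.cast_nonneg (α := ℤ) L])
            fun _ => norm_nonneg _).trans hS) ?_
          rw [← nsmul_eq_mul]
          exact Finset.sum_le_card_nsmul _ _ _ fun x hx =>
            hg x (Finset.mem_Icc.1 hx).1 (Finset.mem_Icc.1 hx).2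
  · rintro ⟨x, t⟩ hc
    have hvert := mem_cubes.1 hc
    dsimp only at hvert ⊢
    have hsum : (2 * (l : ℝ) + 1) ^ (2 * k) * ‖cubeDiff t g x‖ ≤
        2 ^ k * ((2 * l + 1) ^ k * (k / (2 * l + 1) * S)) + 2 ^ k * ((2 * l + 1) ^ (k - 1) * S) := by
      calc (2 * (l : ℝ) + 1) ^ (2 * k) * ‖cubeDiff t g x‖
          = ∑ c ∈ box (Fin k) l ×ˢ box (Fin k) l, ‖cubeDiff t g x‖ := by
            rw [Finset.sum_const, Finset.card_product, card_box, Fintype.card_fin, nsmul_eq_mul]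
            push_cast
            ring
        _ ≤ ∑ c ∈ box (Fin k) l ×ˢ box (Fin k) l, (∑ ω : Fin k → Bool,
              ‖predict φ (x - dot ω t) (fun i => c.1 i + dot ω c.2) - g (x - dot ω t)‖
            + ∑ η ∈ Finset.univ.erase (fun _ : Fin k => false),
              ‖cubeDiff (fun i => t i + dot η (fun _ => 1) * c.2 i) φ (x - dot η c.1)‖) :=
            Finset.sum_le_sum fun c _ => norm_cubeDiff_le_sum φ g x t c.1 c.2
        _ ≤ _ := by
            rw [Finset.sum_add_distrib, Finset.sum_comm]
            nth_rewrite 2 [Finset.sum_comm]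
            have hcard : ((Finset.univ : Finset (Fin k → Bool)).card : ℝ) = 2 ^ k := by simp
            refine add_le_add ?_ ?_
            · rw [← hcard, ← nsmul_eq_mul]
              refine Finset.sum_le_card_nsmul _ _ _ fun ω _ => ?_
              -- For fixed `b` and `ω`, the map `a ↦ a + dot ω b` is injective into the larger box,
              -- so only the choice of `b` is repeated.
              have := sum_comp_le (S := box (Fin k) l ×ˢ box (Fin k) l) (T := box (Fin k) L)
                (Q := box (Fin k) l) (fun c i => c.1 i + dot ω c.2) (fun c => c.2)
                (by
                  intro c hc
                  rw [Finset.mem_product, mem_box, mem_box] at hc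
                  rw [mem_box]
                  intro i
                  refine (abs_add_le _ _).trans ?_
                  have := abs_dot_le hc.2 ω
                  rw [hL]; push_cast
                  linarith [hc.1 i])
                (fun c hc => (Finset.mem_product.1 hc).2)
                (by
                  intro c _ d _ h1 h2
                  refine Prod.ext (funext fun i => ?_) h2
                  have := congrFun h1 i
                  simp only [h2] at this
                  exact add_right_cancel this)
                (W := fun u => ‖predict φ (x - dot ω t) u - g (x - dot ω t)‖)
                (fun _ => norm_nonneg _)
              refine this.trans ?_
              rw [card_box, Fintype.card_fin]
              push_cast
              exact mul_le_mul_of_nonneg_left (hg _ (hvert ω).1 (hvert ω).2) (by positivity)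
            · refine le_trans (Finset.sum_le_card_nsmul _ _
                ((2 * (l : ℝ) + 1) ^ (k - 1) * S) fun η hη => ?_) ?_
              · obtain ⟨i, hi⟩ : ∃ i, η i = true := by
                  by_contra! h
                  exact Finset.ne_of_mem_erase hη (funext fun i => by simpa using h i)
                refine (sum_cubeDiff_shift_le ?_ φ hc hi).trans
                  (mul_le_mul_of_nonneg_left hS (by positivity))
                nlinarith [Nat.cast_nonneg (α := ℤ) k, Nat.cast_nonneg (α := ℤ) l,
                  mul_nonneg (Nat.cast_nonneg (α := ℤ) k) (Nat.cast_nonneg (α := ℤ) l),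
                  mul_nonneg (Nat.cast_nonneg (α := ℤ) k) (mul_nonneg (Nat.cast_nonneg (α := ℤ) k)
                    (Nat.cast_nonneg (α := ℤ) l))]
              · rw [nsmul_eq_mul, ← hcard]
                exact mul_le_mul_of_nonneg_right (by
                  exact_mod_cast Finset.card_le_card (Finset.erase_subset _ _)) (by positivity)
    obtain ⟨j, rfl⟩ : ∃ j, k = j + 1 := ⟨k - 1, by omega⟩
    rw [Nat.add_sub_cancel] at hsum
    have hpow : (0 : ℝ) < (2 * (l : ℝ) + 1) ^ j := by positivity
    refine le_of_mul_le_mul_left ?_ hpow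
    calc (2 * (l : ℝ) + 1) ^ j * ((2 * (l : ℝ) + 1) ^ (j + 1 + 1) * ‖cubeDiff t g x‖)
        = (2 * (l : ℝ) + 1) ^ (2 * (j + 1)) * ‖cubeDiff t g x‖ := by ring
      _ ≤ _ := hsum
      _ = _ := by
        push_cast
        field_simp
        ring
end

/-! ### Gowers norms as averages over cubes. -/

/-- The product of `F` over the vertices of a cube, conjugated at the vertices of negative sign. -/
def cubeProd {k : ℕ} {G : Type*} [AddCommGroup G] (h : Fin k → G) (F : G → ℂ) (x : G) : ℂ :=
  ∏ ω : Fin k → Bool,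
    if sgn ω = 1 then F (x - dot ω h) else (starRingEnd ℂ) (F (x - dot ω h))

theorem prod_insertNth {k : ℕ} {A : Type*} [CommMonoid A] (i : Fin (k + 1))
    (F : (Fin (k + 1) → Bool) → A) :
    ∏ ω, F ω = (∏ ω : Fin k → Bool, F (i.insertNth true ω))
      * ∏ ω : Fin k → Bool, F (i.insertNth false ω) := by
  rw [← (Fin.insertNthEquiv (fun _ => Bool) i).prod_comp, Fintype.prod_prod_type]
  simp [Fin.insertNthEquiv]

section
variable {k : ℕ} {G : Type*} [AddCommGroup G]

theorem cubeProd_cons (a : G) (h : Fin k → G) (F : G → ℂ) (x : G) :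
    cubeProd (Fin.cons a h : Fin (k + 1) → G) F x
      = cubeProd h (fun y => shift a F y * (starRingEnd ℂ) (F y)) x := by
  rw [← Fin.insertNth_zero' a h]
  simp only [cubeProd]
  rw [prod_insertNth 0, ← Finset.prod_mul_distrib]
  refine Finset.prod_congr rfl fun ω _ => ?_
  rw [dot_insertNth, dot_insertNth, sgn_insertNth, sgn_insertNth]
  have h5 : x - (a + dot ω h) = x - dot ω h - a := by abel
  rcases sgn_eq_or ω with h | h <;> simp [h, shift, h5]

variable [Fintype G]

theorem gowersNorm_nonneg (k : ℕ) (F : G → ℂ) : 0 ≤ gowersNorm k F := by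
  match k with
  | 0 => simp [gowersNorm]
  | 1 => simp only [gowersNorm]; positivity
  | k + 2 =>
    simp only [gowersNorm]
    exact Real.rpow_nonneg (div_nonneg (Finset.sum_nonneg fun h _ =>
      pow_nonneg (gowersNorm_nonneg (k + 1) _) _) (Nat.cast_nonneg _)) _

omit [AddCommGroup G] in
theorem sum_fin_cons (Φ : (Fin (k + 1) → G) → ℂ) :
    ∑ h, Φ h = ∑ a : G, ∑ h : Fin k → G, Φ (Fin.cons a h : Fin (k + 1) → G) := by
  rw [← (Fin.consEquiv fun _ => G).sum_comp, Fintype.sum_prod_type]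
  rfl

/-- Each level of the recursion contributes one step to the cube. The base case is the expansion of
`|∑ F|^2` as a double sum. -/
theorem gowersNorm_pow (k : ℕ) (F : G → ℂ) :
    ((gowersNorm (k + 1) F ^ 2 ^ (k + 1) : ℝ) : ℂ) * (Fintype.card G : ℂ) ^ (k + 2)
      = ∑ h : Fin (k + 1) → G, ∑ x, cubeProd h F x := by
  have hcard : (Fintype.card G : ℂ) ≠ 0 := by exact_mod_cast Fintype.card_ne_zero
  rw [sum_fin_cons]
  simp only [cubeProd_cons]
  induction k generalizing F with
  | zero =>
    have h0 : ∀ (h : Fin 0 → G) (f : G → ℂ) (x : G), cubeProd h f x = f x := fun h f x => by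
      simp [cubeProd, sgn, dot]
    simp only [h0, Finset.univ_unique, Finset.sum_singleton]
    rw [Finset.sum_comm]
    have h1 : ∀ y : G, ∑ x, shift x F y * (starRingEnd ℂ) (F y)
        = (∑ x, F x) * (starRingEnd ℂ) (F y) := fun y => by
      rw [← Finset.sum_mul]
      congr 1
      exact (Equiv.subLeft y).sum_comp F
    simp only [h1]
    rw [← Finset.mul_sum, ← map_sum, Complex.mul_conj', gowersNorm, norm_div]
    push_cast
    rw [Complex.norm_natCast]
    rw [Complex.ofReal_natCast]
    field_simp
  | succ k ih =>
    have h1 : gowersNorm (k + 1 + 1) F ^ 2 ^ (k + 1 + 1) =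
        (∑ h : G, gowersNorm (k + 1) (fun x => shift h F x * (starRingEnd ℂ) (F x)) ^ 2 ^ (k + 1))
          / (Fintype.card G : ℝ) := by
      rw [gowersNorm, ← Real.rpow_natCast, ← Real.rpow_mul]
      · push_cast
        rw [one_div, inv_mul_cancel₀ (by positivity), Real.rpow_one]
      · exact div_nonneg (Finset.sum_nonneg fun h _ =>
          pow_nonneg (gowersNorm_nonneg (k + 1) _) _) (Nat.cast_nonneg _)
    rw [h1]
    have h2 : ∀ a : G, ∑ h : Fin (k + 1) → G, ∑ x,
        cubeProd h (fun y => shift a F y * (starRingEnd ℂ) (F y)) x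
        = ((gowersNorm (k + 1) (fun x => shift a F x * (starRingEnd ℂ) (F x)) ^ 2 ^ (k + 1) : ℝ) : ℂ)
          * (Fintype.card G : ℂ) ^ (k + 2) := fun a => by
      rw [ih, sum_fin_cons]
      simp only [cubeProd_cons]
    simp only [h2]
    rw [← Finset.sum_mul]
    push_cast
    field_simp
    ring

end

/-- The extension by zero of a function on `[N]` to the integers. -/
def zeroExt {N : ℕ} (f : Interval N → ℂ) (n : ℤ) : ℂ :=
  if hn : n ∈ Set.Icc (1 : ℤ) (N : ℤ) then f ⟨n, hn⟩ else 0

theorem zeroExt_coe {N : ℕ} (f : Interval N → ℂ) (n : Interval N) : zeroExt f n = f n := by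
  have : (n : ℤ) ∈ Set.Icc (1 : ℤ) (N : ℤ) := n.2
  simp [zeroExt, this]

section
variable {N M : ℕ}

theorem intCast_inj_of_mem (hM : N < M) {a b : ℤ} (ha : 1 ≤ a ∧ a ≤ N) (hb : 1 ≤ b ∧ b ≤ N)
    (hab : (a : ZMod M) = b) : a = b := by
  rw [ZMod.intCast_eq_intCast_iff_dvd_sub] at hab
  have := Int.eq_zero_of_abs_lt_dvd hab (by rw [abs_lt]; omega)
  omega

variable [NeZero M]

theorem extendZero_intCast (hM : N < M) (f : Interval N → ℂ) {n : ℤ} (hn : 1 ≤ n ∧ n ≤ N) :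
    extendZero M f (n : ZMod M) = zeroExt f n := by
  have : ((n : ZMod M).val : ℤ) = n := by
    rw [ZMod.val_intCast]
    exact Int.emod_eq_of_lt (by omega) (by omega)
  change zeroExt f ((n : ZMod M).val : ℤ) = _
  rw [this]

omit [NeZero M] in
theorem val_mem_of_extendZero_ne {f : Interval N → ℂ} {x : ZMod M} (hx : extendZero M f x ≠ 0) :
    1 ≤ (x.val : ℤ) ∧ (x.val : ℤ) ≤ N := by
  by_contra h
  exact hx (dif_neg h)

omit [NeZero M] in
theorem intCast_sub_dot {k : ℕ} (ω : Fin k → Bool) (x : ℤ) (h : Fin k → ℤ) :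
    ((x - dot ω h : ℤ) : ZMod M) = (x : ZMod M) - dot ω fun i => (h i : ZMod M) := by
  simp [dot, apply_ite (Int.cast : ℤ → ZMod M)]

/-- In a large cyclic group the Gowers sum only involves cubes of integers in `[N]`. -/
theorem sum_cubeProd_zmod (k : ℕ) (hM : 2 ^ k * N < M) (f : Interval N → ℂ) :
    ∑ h : Fin k → ZMod M, ∑ x, cubeProd h (extendZero M f) x
      = ∑ c ∈ cubes k 1 N, cubeProd c.2 (zeroExt f) c.1 := by
  have hk : k + 1 ≤ 2 ^ k := Nat.lt_two_pow_self
  have hkN : (k + 1) * N < M := lt_of_le_of_lt (Nat.mul_le_mul_right N hk) hM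
  have hN : N < M := by nlinarith
  rw [Finset.sum_comm, ← Fintype.sum_prod_type']
  symm
  refine Finset.sum_of_injOn (fun c => ((c.1 : ZMod M), fun i => (c.2 i : ZMod M))) ?_ ?_ ?_ ?_
  · rintro ⟨x, h⟩ hc ⟨x', h'⟩ hc' heq
    rw [Finset.mem_coe, mem_cubes] at hc hc'
    rw [Prod.mk.injEq] at heq
    have key : ∀ ω, x - dot ω h = x' - dot ω h' := fun ω => by
      refine intCast_inj_of_mem hN (hc ω) (hc' ω) ?_
      rw [intCast_sub_dot, intCast_sub_dot, heq.1, heq.2]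
    have hx : x = x' := by simpa using key fun _ => false
    refine Prod.ext hx (funext fun i => ?_)
    have := key fun j => decide (j = i)
    rw [dot_single, dot_single] at this
    dsimp only
    omega
  · simp [Set.MapsTo]
  · rintro ⟨x, h⟩ - hnot
    by_contra hne
    apply hnot
    have hv : ∀ ω, 1 ≤ ((x - dot ω h).val : ℤ) ∧ ((x - dot ω h).val : ℤ) ≤ N := by
      intro ω
      refine val_mem_of_extendZero_ne (f := f) fun h0 => hne ?_
      exact Finset.prod_eq_zero (Finset.mem_univ ω) (by simp [h0])
    have hx := hv fun _ => false
    rw [dot_false, sub_zero] at hx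
    have hi : ∀ i, 1 ≤ ((x - h i).val : ℤ) ∧ ((x - h i).val : ℤ) ≤ N := fun i => by
      simpa [dot_single] using hv fun j => decide (j = i)
    have hcast : ∀ i, (((x.val : ℤ) - (x - h i).val : ℤ) : ZMod M) = h i := fun i => by simp
    refine ⟨((x.val : ℤ), fun i => (x.val : ℤ) - (x - h i).val), ?_, by simp⟩
    rw [Finset.mem_coe, mem_cubes]
    intro ω
    have hdot := abs_dot_le (L := N) (h := fun i => (x.val : ℤ) - (x - h i).val)
      (fun i => by have := hi i; rw [abs_le]; omega) ω
    -- The steps are read off from the neighbours of the base vertex. The remaining vertices then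
    -- agree modulo `M`, and both sides differ by less than `(k + 1) * N < M`, so no wraparound
    -- occurs.
    have heq : (x.val : ℤ) - dot ω (fun i => (x.val : ℤ) - (x - h i).val) = (x - dot ω h).val := by
      have hdvd : (M : ℤ) ∣ (x - dot ω h).val -
          ((x.val : ℤ) - dot ω (fun i => (x.val : ℤ) - (x - h i).val)) := by
        rw [← ZMod.intCast_eq_intCast_iff_dvd_sub, intCast_sub_dot]
        simp
      have hω := hv ω
      have hkN' : ((k : ℤ) + 1) * N < M := by exact_mod_cast hkN
      rw [abs_le] at hdot
      have := Int.eq_zero_of_abs_lt_dvd hdvd (by rw [abs_lt]; constructor <;> linarith)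
      linarith
    dsimp only
    rw [heq]
    exact hv ω
  · rintro ⟨x, h⟩ hc
    rw [mem_cubes] at hc
    refine Finset.prod_congr rfl fun ω _ => ?_
    dsimp only
    rw [← intCast_sub_dot, extendZero_intCast hN f (hc ω)]

theorem cubes_nonempty (k : ℕ) (hN : 1 ≤ N) : (cubes k 1 N).Nonempty :=
  ⟨(1, 0), by rw [mem_cubes]; intro ω; simp [dot]; omega⟩

/-- Numerator and denominator carry the same power of `M`, which cancels; the norm of the indicator
function counts the cubes. -/
theorem gowersNormInterval_pow {k : ℕ} (hk : 1 ≤ k) (hN : 1 ≤ N) (hM : 2 ^ k * N < M)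
    (f : Interval N → ℂ) :
    ((gowersNormInterval k M f ^ 2 ^ k : ℝ) : ℂ) * ((cubes k 1 N).card : ℂ)
      = ∑ c ∈ cubes k 1 N, cubeProd c.2 (zeroExt f) c.1 := by
  obtain ⟨j, rfl⟩ : ∃ j, k = j + 1 := ⟨k - 1, by omega⟩
  have h1 := gowersNorm_pow j (extendZero M fun _ : Interval N => (1 : ℂ))
  have h2 := gowersNorm_pow j (extendZero M f)
  rw [sum_cubeProd_zmod _ hM] at h1 h2
  have hone : ∑ c ∈ cubes (j + 1) 1 N, cubeProd c.2 (zeroExt fun _ : Interval N => (1 : ℂ)) c.1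
      = (cubes (j + 1) 1 N).card := by
    rw [Finset.card_eq_sum_ones, Nat.cast_sum, Nat.cast_one]
    refine Finset.sum_congr rfl fun c hc => ?_
    rw [mem_cubes] at hc
    refine Finset.prod_eq_one fun ω _ => ?_
    have : zeroExt (fun _ : Interval N => (1 : ℂ)) (c.1 - dot ω c.2) = 1 := dif_pos (hc ω)
    simp [this]
  rw [hone] at h1
  have hcard : ((cubes (j + 1) 1 N).card : ℂ) ≠ 0 := by
    exact_mod_cast (Finset.card_pos.2 (cubes_nonempty (j + 1) hN)).ne'
  rw [← h2, gowersNormInterval, div_pow, Complex.ofReal_div, ← h1]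
  rw [← h1] at hcard
  have := left_ne_zero_of_mul hcard
  field_simp

end

/-! ### Phases and the defect of a cube product. -/

theorem e_add (a b : UnitAddCircle) : e (a + b) = e a * e b := by
  simp [e, AddCircle.toCircle_add]

theorem e_zero : e 0 = 1 := by simp [e]

theorem norm_e (a : UnitAddCircle) : ‖e a‖ = 1 := Circle.norm_coe _

theorem e_neg (a : UnitAddCircle) : e (-a) = (starRingEnd ℂ) (e a) := by
  rw [e, AddCircle.toCircle_neg, Circle.coe_inv_eq_conj, e]

theorem e_sum {ι : Type*} (s : Finset ι) (z : ι → UnitAddCircle) :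
    e (∑ i ∈ s, z i) = ∏ i ∈ s, e (z i) := by
  classical
  induction s using Finset.induction_on with
  | empty => simp [e_zero]
  | insert i s hi ih => rw [Finset.sum_insert hi, Finset.prod_insert hi, e_add, ih]

theorem e_coe (r : ℝ) : e (r : UnitAddCircle) = Complex.exp (Complex.I * ((2 * Real.pi * r : ℝ) : ℂ)) := by
  rw [e, AddCircle.toCircle_apply_mk, Circle.coe_exp, mul_comm]
  simp

theorem norm_e_sub_le (a b : UnitAddCircle) : ‖e a - e b‖ ≤ 2 * Real.pi * ‖a - b‖ := by
  obtain ⟨r, hr, hr'⟩ := exists_real_lift (a - b)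
  have h1 : e a - e b = (e (a - b) - 1) * e b := by
    rw [sub_mul, ← e_add, sub_add_cancel, one_mul]
  rw [h1, norm_mul, norm_e, mul_one, ← hr', ← hr, e_coe]
  refine Real.norm_exp_I_mul_ofReal_sub_one_le.trans (le_of_eq ?_)
  rw [Real.norm_eq_abs, abs_mul, abs_of_pos Real.two_pi_pos]

/-- This is `cos t ≤ 1 - (2 / π²) t²` for `|t| ≤ π`, at `t = 2πr` with `r` the smallest lift. -/
theorem re_e_le (a : UnitAddCircle) : (e a).re ≤ 1 - 8 * ‖a‖ ^ 2 := by
  obtain ⟨r, hr, hr'⟩ := exists_real_lift a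
  have hhalf : |r| ≤ 1 / 2 := by
    rw [hr']
    simpa using AddCircle.norm_le_half_period (1 : ℝ) one_ne_zero (x := a)
  rw [← hr', ← hr, e_coe, mul_comm, Complex.exp_ofReal_mul_I_re]
  have hpi := Real.pi_pos
  have := Real.cos_le_one_sub_mul_cos_sq (x := 2 * Real.pi * r) (by
    rw [abs_mul, abs_of_pos Real.two_pi_pos]; nlinarith)
  refine this.trans (le_of_eq ?_)
  rw [sq_abs]
  field_simp
  ring

theorem exists_phase (z : ℂ) : ∃ a : UnitAddCircle, z = ‖z‖ * e a := by
  by_cases hz : z = 0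
  · exact ⟨0, by simp [hz]⟩
  · refine ⟨((Complex.arg z / (2 * Real.pi) : ℝ) : UnitAddCircle), ?_⟩
    rw [e_coe]
    have hpi := Real.pi_pos.ne'
    have : 2 * Real.pi * (Complex.arg z / (2 * Real.pi)) = Complex.arg z := by field_simp
    rw [this, mul_comm Complex.I, Complex.norm_mul_exp_arg_mul_I]

section
variable {k : ℕ} {G : Type*} [AddCommGroup G]

theorem cubeProd_polar {F : G → ℂ} {φ : G → UnitAddCircle} (h : Fin k → G) (x : G)
    (hF : ∀ ω, F (x - dot ω h) = ‖F (x - dot ω h)‖ * e (φ (x - dot ω h))) :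
    cubeProd h F x = ((∏ ω, ‖F (x - dot ω h)‖ : ℝ) : ℂ) * e (cubeDiff h φ x) := by
  rw [cubeDiff, e_sum]
  push_cast
  rw [← Finset.prod_mul_distrib]
  refine Finset.prod_congr rfl fun ω _ => ?_
  rw [hF ω]
  generalize φ (x - dot ω h) = a
  rw [norm_mul, norm_e, mul_one, Complex.norm_real, norm_norm]
  rcases sgn_eq_or ω with h1 | h1
  · simp [h1]
  · simp [h1, e_neg]

theorem prod_norm_le {F : G → ℂ} {h : Fin k → G} {x : G}
    (hF1 : ∀ ω, ‖F (x - dot ω h)‖ ≤ 1) : ∏ ω, ‖F (x - dot ω h)‖ ≤ ‖F x‖ := by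
  rw [← Finset.mul_prod_erase _ _ (Finset.mem_univ fun _ : Fin k => false), dot_false, sub_zero]
  exact mul_le_of_le_one_right (norm_nonneg _)
    (Finset.prod_le_one (fun _ _ => norm_nonneg _) fun ω _ => hF1 ω)

theorem re_cubeProd_le {F : G → ℂ} {φ : G → UnitAddCircle} {h : Fin k → G} {x : G}
    (hF : ∀ ω, F (x - dot ω h) = ‖F (x - dot ω h)‖ * e (φ (x - dot ω h)))
    (hF1 : ∀ ω, ‖F (x - dot ω h)‖ ≤ 1) :
    (cubeProd h F x).re ≤ ‖F x‖ ∧ (cubeProd h F x).re ≤ 1 - 4 * ‖cubeDiff h φ x‖ ^ 2 := by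
  have h0 : 0 ≤ ∏ ω, ‖F (x - dot ω h)‖ := Finset.prod_nonneg fun _ _ => norm_nonneg _
  have hle := prod_norm_le hF1
  have h1 : ∏ ω, ‖F (x - dot ω h)‖ ≤ 1 :=
    Finset.prod_le_one (fun _ _ => norm_nonneg _) fun ω _ => hF1 ω
  rw [cubeProd_polar h x hF, Complex.re_ofReal_mul]
  set ρ := ∏ ω, ‖F (x - dot ω h)‖
  have he := re_e_le (cubeDiff h φ x)
  have hhalf : ‖cubeDiff h φ x‖ ≤ 1 / 2 := by
    simpa using AddCircle.norm_le_half_period (1 : ℝ) one_ne_zero (x := cubeDiff h φ x)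
  have hn := norm_nonneg (cubeDiff h φ x)
  constructor
  · nlinarith [sq_nonneg ‖cubeDiff h φ x‖]
  -- If the real part is negative, multiplying by the modulus `ρ` may raise it, but only up to 0.
  -- The constant 4 absorbs this, since circle norms are at most `1 / 2`.
  · rcases le_total 0 (e (cubeDiff h φ x)).re with hre | hre <;> nlinarith

end

/-! ### From the norm on `[N]` to defects summed over cubes. -/

theorem mem_cubes_of_nonneg {k : ℕ} {A B x : ℤ} {h : Fin k → ℤ} (hh : ∀ i, 0 ≤ h i) (hx : x ≤ B)
    (hA : A ≤ x - ∑ i, h i) : (x, h) ∈ cubes k A B := by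
  rw [mem_cubes]
  intro ω
  have h0 : 0 ≤ dot ω h := Finset.sum_nonneg fun i _ => by
    split_ifs
    · exact hh i
    · exact le_rfl
  have h1 : dot ω h ≤ ∑ i, h i := Finset.sum_le_sum fun i _ => by
    split_ifs
    · exact le_rfl
    · exact hh i
  dsimp only
  omega

/-- A cube is determined by its base vertex and the `k` neighbours of that vertex, all in `[1, N]`.
-/
theorem card_cubes_le (k N : ℕ) : (cubes k 1 N).card ≤ N ^ (k + 1) := by
  have : (cubes k 1 N).card ≤
      (Finset.Icc (1 : ℤ) N ×ˢ Fintype.piFinset fun _ : Fin k => Finset.Icc (1 : ℤ) N).card := by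
    refine Finset.card_le_card_of_injOn (fun c => (c.1, fun i => c.1 - c.2 i)) ?_ ?_
    · intro c hc
      rw [Finset.mem_coe, mem_cubes] at hc
      have h0 := hc fun _ => false
      rw [dot_false, sub_zero] at h0
      simp only [Finset.coe_product, Set.mem_prod, Finset.mem_coe, Fintype.mem_piFinset,
        Finset.mem_Icc]
      exact ⟨h0, fun i => by simpa [dot_single] using hc fun j => decide (j = i)⟩
    · rintro ⟨x, h⟩ - ⟨x', h'⟩ - heq
      simp only [Prod.mk.injEq] at heq
      obtain ⟨rfl, h2⟩ := heq
      refine Prod.ext rfl (funext fun i => ?_)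
      simpa using congrFun h2 i
  refine this.trans (le_of_eq ?_)
  simp [Fintype.card_piFinset, pow_succ, mul_comm]

section
variable {N : ℕ} {f : Interval N → ℂ}

theorem norm_zeroExt_le (hf : ∀ n, ‖f n‖ ≤ 1) (n : ℤ) : ‖zeroExt f n‖ ≤ 1 := by
  unfold zeroExt
  split_ifs
  · exact hf _
  · simp

theorem l1Norm_eq (P : ℤ → UnitAddCircle) :
    l1Norm (fun n => f n - e (P n))
      = (∑ n ∈ Finset.Icc (1 : ℤ) N, ‖zeroExt f n - e (P n)‖) / N := by
  rw [l1Norm]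
  congr 1
  rw [Finset.sum_subtype (Finset.Icc (1 : ℤ) N) (p := fun n => n ∈ Set.Icc (1 : ℤ) (N : ℤ))
    (fun n => by rw [Finset.mem_Icc, Set.mem_Icc])]
  exact Finset.sum_congr rfl fun n _ => by rw [zeroExt_coe]

theorem gowersNormInterval_nonneg (k M : ℕ) [NeZero M] (f : Interval N → ℂ) :
    0 ≤ gowersNormInterval k M f :=
  div_nonneg (gowersNorm_nonneg _ _) (gowersNorm_nonneg _ _)

/-- Bernoulli's inequality `(1 - ε) ^ 2 ^ k ≥ 1 - 2 ^ k * ε` bounds the average defect. -/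
theorem sum_one_sub_re_le {k M : ℕ} [NeZero M] (hk : 1 ≤ k) (hN : 1 ≤ N) (hM : 2 ^ k * N < M)
    {ε : ℝ} (hε : 0 ≤ ε) (hε1 : ε ≤ 1) (hnorm : 1 - ε ≤ gowersNormInterval k M f) :
    ∑ c ∈ cubes k 1 N, (1 - (cubeProd c.2 (zeroExt f) c.1).re) ≤ 2 ^ k * ε * (N : ℝ) ^ (k + 1) := by
  have h1 := congrArg Complex.re (gowersNormInterval_pow hk hN hM f)
  rw [Complex.re_ofReal_mul, Complex.natCast_re, Complex.re_sum] at h1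
  rw [Finset.sum_sub_distrib, ← h1]
  have h2 : 1 - 2 ^ k * ε ≤ gowersNormInterval k M f ^ 2 ^ k := by
    have := one_add_mul_le_pow (a := -ε) (by linarith) (2 ^ k)
    push_cast at this
    have h3 : (1 + -ε) ^ 2 ^ k ≤ gowersNormInterval k M f ^ 2 ^ k :=
      pow_le_pow_left₀ (by linarith) (by linarith) _
    linarith
  have h3 : ((cubes k 1 N).card : ℝ) ≤ (N : ℝ) ^ (k + 1) := by exact_mod_cast card_cubes_le k N
  have h4 : (0 : ℝ) ≤ (cubes k 1 N).card := Nat.cast_nonneg _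
  rw [Finset.sum_const, nsmul_eq_mul, mul_one]
  calc _ = (1 - gowersNormInterval k M f ^ 2 ^ k) * (cubes k 1 N).card := by ring
    _ ≤ (2 ^ k * ε) * (cubes k 1 N).card := mul_le_mul_of_nonneg_right (by linarith) h4
    _ ≤ _ := mul_le_mul_of_nonneg_left h3 (by positivity)

theorem one_sub_re_cubeProd {k : ℕ} (hf : ∀ n, ‖f n‖ ≤ 1) {φ : ℤ → UnitAddCircle}
    (hφ : ∀ n, zeroExt f n = ‖zeroExt f n‖ * e (φ n)) (c : ℤ × (Fin k → ℤ)) :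
    1 - ‖zeroExt f c.1‖ ≤ 1 - (cubeProd c.2 (zeroExt f) c.1).re ∧
      4 * ‖cubeDiff c.2 φ c.1‖ ^ 2 ≤ 1 - (cubeProd c.2 (zeroExt f) c.1).re := by
  have := re_cubeProd_le (h := c.2) (x := c.1) (fun ω => hφ (c.1 - dot ω c.2))
    fun ω => norm_zeroExt_le hf _
  constructor <;> linarith [this.1, this.2]

theorem one_sub_re_cubeProd_nonneg {k : ℕ} (hf : ∀ n, ‖f n‖ ≤ 1) (c : ℤ × (Fin k → ℤ)) :
    0 ≤ 1 - (cubeProd c.2 (zeroExt f) c.1).re := by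
  choose φ hφ using fun n => exists_phase (zeroExt f n)
  exact le_trans (by positivity) (one_sub_re_cubeProd hf hφ c).2

theorem gowersNormInterval_eq_one {k M : ℕ} [NeZero M] (hk : 1 ≤ k) (hN : 1 ≤ N)
    (hM : 2 ^ k * N < M) {P : ℤ → UnitAddCircle} (hP : IsPolynomialOfDegreeLE ((k : ℤ) - 1) P)
    (hfP : ∀ n, f n = e (P n)) : gowersNormInterval k M f = 1 := by
  have h1 := gowersNormInterval_pow hk hN hM f
  have h2 : ∀ c ∈ cubes k 1 N, cubeProd c.2 (zeroExt f) c.1 = 1 := by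
    intro c hc
    rw [mem_cubes] at hc
    have hv : ∀ ω, zeroExt f (c.1 - dot ω c.2) = e (P (c.1 - dot ω c.2)) := fun ω =>
      (dif_pos (hc ω)).trans (hfP _)
    rw [cubeProd_polar (φ := P) _ _ fun ω => by rw [hv, norm_e]; simp]
    rw [(isPolynomialOfDegreeLE_iff P).1 hP, e_zero]
    simp [hv, norm_e]
  rw [Finset.sum_congr rfl h2, Finset.sum_const, nsmul_eq_mul, mul_one] at h1
  have hcard : ((cubes k 1 N).card : ℂ) ≠ 0 := by
    exact_mod_cast (Finset.card_pos.2 (cubes_nonempty k hN)).ne'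
  have h3 : gowersNormInterval k M f ^ 2 ^ k = 1 := by
    have := mul_right_cancel₀ hcard (h1.trans (one_mul _).symm)
    exact_mod_cast this
  exact (pow_eq_one_iff_of_nonneg (gowersNormInterval_nonneg _ _ _) (by positivity)).1 h3

end

/-! ### Extremisers and near-extremisers. -/

/-- Functions on long intervals whose Gowers norm is at least `1 - ε` are within `δ` in `L^1` of a
polynomial phase. -/
def NearPolynomial (k : ℕ) (ε δ : ℝ) : Prop :=
  ∀ N : ℕ, 2 * k + 2 ≤ N → ∀ (M : ℕ) [NeZero M], 2 ^ k * N < M →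
    ∀ f : Interval N → ℂ, (∀ n, ‖f n‖ ≤ 1) → 1 - ε ≤ gowersNormInterval k M f →
      ∃ P : ℤ → UnitAddCircle, IsPolynomialOfDegreeLE ((k : ℤ) - 1) P ∧
        l1Norm (fun n => f n - e (P n)) ≤ δ

/-- A sum of nonnegative defects that is at most 0 vanishes term by term, so the phase has zero
differences and the modulus is 1, by degenerate cubes. -/
theorem nearPolynomial_zero {k : ℕ} (hk : 1 ≤ k) : NearPolynomial k 0 0 := by
  intro N hN M _ hM f hf hnorm
  have hsum := sum_one_sub_re_le (f := f) hk (by omega) hM le_rfl zero_le_one hnorm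
  rw [mul_zero, zero_mul] at hsum
  choose φ hφ using fun n => exists_phase (zeroExt f n)
  have hzero : ∀ c ∈ cubes k 1 N, 1 - (cubeProd c.2 (zeroExt f) c.1).re = 0 :=
    (Finset.sum_eq_zero_iff_of_nonneg fun c _ => one_sub_re_cubeProd_nonneg hf c).1
      (le_antisymm hsum (Finset.sum_nonneg fun c _ => one_sub_re_cubeProd_nonneg hf c))
  obtain ⟨C, -, H⟩ := exists_circle_polynomial_near k hk
  obtain ⟨P, hP, hPφ⟩ := H 1 N 0 φ (by omega) (by norm_num) (by
    intro h hh x hx hA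
    have hc := mem_cubes_of_nonneg hh hx hA
    have := (one_sub_re_cubeProd hf hφ (x, h)).2
    rw [hzero _ hc] at this
    dsimp only at this
    nlinarith [norm_nonneg (cubeDiff h φ x)])
  refine ⟨P, hP, ?_⟩
  rw [l1Norm_eq, Finset.sum_eq_zero, zero_div]
  intro n hn
  rw [Finset.mem_Icc] at hn
  have hc : ((n, fun _ => 0) : ℤ × (Fin k → ℤ)) ∈ cubes k 1 N :=
    mem_cubes_of_nonneg (fun _ => le_rfl) hn.2 (by simpa using hn.1)
  have h1 := (one_sub_re_cubeProd hf hφ (n, fun _ : Fin k => 0)).1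
  rw [hzero _ hc] at h1
  have h2 := norm_zeroExt_le hf n
  have h3 : ‖zeroExt f n‖ = 1 := le_antisymm h2 (by simpa using h1)
  have h4 := hPφ n hn.1 hn.2
  rw [mul_zero, norm_le_zero_iff, sub_eq_zero] at h4
  rw [hφ n, h3, h4]
  simp

/-- Cauchy–Schwarz: the defects control squares of the differences, while self-correction needs
first powers. -/
theorem sum_norm_cubeDiff_le {k N : ℕ} {f : Interval N → ℂ} (hf : ∀ n, ‖f n‖ ≤ 1)
    {φ : ℤ → UnitAddCircle} (hφ : ∀ n, zeroExt f n = ‖zeroExt f n‖ * e (φ n)) {θ : ℝ} (hθ : 0 ≤ θ)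
    (hsum : ∑ c ∈ cubes k 1 N, (1 - (cubeProd c.2 (zeroExt f) c.1).re)
      ≤ θ ^ 2 * (N : ℝ) ^ (k + 1)) :
    ∑ c ∈ cubes k 1 N, ‖cubeDiff c.2 φ c.1‖ ≤ θ * (N : ℝ) ^ (k + 1) := by
  refine abs_le_of_sq_le_sq' ?_ (by positivity) |>.2
  have h1 : ∑ c ∈ cubes k 1 N, ‖cubeDiff c.2 φ c.1‖ ^ 2 ≤ θ ^ 2 * (N : ℝ) ^ (k + 1) := by
    refine (Finset.sum_le_sum fun c _ => ?_).trans hsum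
    have := (one_sub_re_cubeProd hf hφ c).2
    nlinarith [sq_nonneg ‖cubeDiff c.2 φ c.1‖]
  have h3 : ((cubes k 1 N).card : ℝ) ≤ (N : ℝ) ^ (k + 1) := by exact_mod_cast card_cubes_le k N
  calc _ ≤ ((cubes k 1 N).card : ℝ) * ∑ c ∈ cubes k 1 N, ‖cubeDiff c.2 φ c.1‖ ^ 2 :=
        sq_sum_le_card_mul_sum_sq
    _ ≤ (N : ℝ) ^ (k + 1) * (θ ^ 2 * (N : ℝ) ^ (k + 1)) := by gcongr
    _ = _ := by ring

theorem norm_sub_e_le {z : ℂ} {a b d : UnitAddCircle} (hz : z = ‖z‖ * e a) (hz1 : ‖z‖ ≤ 1) :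
    ‖z - e d‖ ≤ (1 - ‖z‖) + 2 * Real.pi * ‖a - b‖ + 2 * Real.pi * ‖b - d‖ := by
  have h1 : ‖z - e a‖ = 1 - ‖z‖ := by
    have : z - e a = ((‖z‖ - 1 : ℝ) : ℂ) * e a := by
      push_cast
      rw [sub_mul, ← hz, one_mul]
    rw [this, norm_mul, norm_e, mul_one, Complex.norm_real, Real.norm_eq_abs,
      abs_of_nonpos (by linarith)]
    ring
  calc ‖z - e d‖ = ‖(z - e a) + (e a - e b) + (e b - e d)‖ := by congr 1; ring
    _ ≤ ‖z - e a‖ + ‖e a - e b‖ + ‖e b - e d‖ := norm_add₃_le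
    _ ≤ _ := by rw [h1]; gcongr <;> exact norm_e_sub_le _ _

theorem sum_Icc_le_inner_add {N : ℕ} {m : ℤ} (hm : 0 ≤ m) (hmN : 2 * m ≤ N) {u : ℤ → ℝ}
    (hu : ∀ n, u n ≤ 2) :
    ∑ n ∈ Finset.Icc (1 : ℤ) N, u n ≤ ∑ n ∈ Finset.Icc (1 + m) (N - m), u n + 4 * m := by
  have hsub : Finset.Icc (1 + m) (N - m) ⊆ Finset.Icc (1 : ℤ) N :=
    Finset.Icc_subset_Icc (by omega) (by omega)
  rw [← Finset.sum_sdiff hsub, add_comm]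
  have hcard : ((Finset.Icc (1 : ℤ) N \ Finset.Icc (1 + m) (N - m)).card : ℤ) = 2 * m := by
    rw [Finset.card_sdiff_of_subset hsub, Int.card_Icc, Int.card_Icc]
    omega
  have hcard' : ((Finset.Icc (1 : ℤ) N \ Finset.Icc (1 + m) (N - m)).card : ℝ) = 2 * m := by
    exact_mod_cast hcard
  have := Finset.sum_le_card_nsmul (Finset.Icc (1 : ℤ) N \ Finset.Icc (1 + m) (N - m)) u 2
    fun n _ => hu n
  rw [nsmul_eq_mul, hcard'] at this
  linarith

/-- The quantitative form of the inverse theorem for near-extremisers, with a margin `κ N` discarded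
at both ends of the interval. -/
theorem exists_polynomial_l1Norm_le {k : ℕ} (hk : 1 ≤ k) {C : ℝ}
    (hC : ∀ (A B : ℤ) (δ : ℝ) (φ : ℤ → UnitAddCircle), k ≤ B - A → 3 * δ < 1 →
      (∀ h : Fin k → ℤ, (∀ i, 0 ≤ h i) → ∀ x, x ≤ B → A ≤ x - ∑ i, h i →
        ‖cubeDiff h φ x‖ ≤ δ) →
      ∃ P : ℤ → UnitAddCircle, IsPolynomialOfDegreeLE ((k : ℤ) - 1) P ∧
        ∀ x, A ≤ x → x ≤ B → ‖φ x - P x‖ ≤ C * δ)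
    {κ : ℝ} (hκ : 0 < κ) (hκ4 : κ ≤ 1 / 4) {c : ℝ} (hc : c = κ / ((2 * k + 1) * (k + 1)))
    {θ : ℝ} (hθ : 0 ≤ θ) (hθ1 : 3 * (2 ^ k * (k + 1) * θ / c ^ (k + 1)) < 1)
    {N : ℕ} (hN : 2 * k + 2 ≤ N) {f : Interval N → ℂ} (hf : ∀ n, ‖f n‖ ≤ 1)
    (hsum : ∑ c ∈ cubes k 1 N, (1 - (cubeProd c.2 (zeroExt f) c.1).re)
      ≤ θ ^ 2 * (N : ℝ) ^ (k + 1)) :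
    ∃ P : ℤ → UnitAddCircle, IsPolynomialOfDegreeLE ((k : ℤ) - 1) P ∧
      l1Norm (fun n => f n - e (P n)) ≤ θ ^ 2 / c ^ k + 2 * Real.pi * (θ * (1 + k / c) / c ^ k)
        + 2 * Real.pi * (C * (2 ^ k * (k + 1) * θ / c ^ (k + 1))) + 4 * κ := by
  have hN0 : (0 : ℝ) < N := by exact_mod_cast (by omega : 0 < N)
  have hc0 : 0 < c := by rw [hc]; positivity
  choose φ hφ using fun n => exists_phase (zeroExt f n)
  set l : ℕ := ⌊c * N⌋₊ with hl
  have hl1 : (l : ℝ) ≤ c * N := Nat.floor_le (by positivity)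
  -- This holds even when `l = 0`, so `N` need not be large in terms of `c`.
  have hl2 : c * N ≤ 2 * l + 1 := by
    have := Nat.lt_floor_add_one (c * N)
    have h0 : (0 : ℝ) ≤ l := Nat.cast_nonneg _
    rw [← hl] at this
    linarith
  set m : ℤ := (2 * k + 1) * ((k + 1) * l) with hm
  have hm0 : 0 ≤ m := by positivity
  have hmκ : (m : ℝ) ≤ κ * N := by
    have : κ * N = (2 * k + 1) * ((k + 1) * (c * N)) := by rw [hc]; field_simp
    rw [this, hm]
    push_cast
    gcongr
  have hm4 : 4 * m ≤ N := by
    have : 4 * (m : ℝ) ≤ N := by nlinarith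
    exact_mod_cast this
  set J := Finset.Icc (1 + m) ((N : ℤ) - m) with hJ
  have hJcard : (J.card : ℝ) ≤ N := by
    have : J.card ≤ N := by rw [hJ, Int.card_Icc]; omega
    exact_mod_cast this
  have hS := sum_norm_cubeDiff_le hf hφ hθ hsum
  obtain ⟨g, hg1, hg2⟩ := exists_correction hk hm.ge φ hS
  have hNk : (0 : ℝ) < (N : ℝ) ^ k := by positivity
  have hclose : ∑ x ∈ J, ‖φ x - g x‖ ≤ θ * (1 + k / c) / c ^ k * N := by
    have h0 := Finset.sum_nonneg fun x (_ : x ∈ J) => norm_nonneg (φ x - g x)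
    have h1 : (c * N) ^ k * ∑ x ∈ J, ‖φ x - g x‖ ≤
        θ * N ^ (k + 1) + N * (k / (c * N) * (θ * N ^ (k + 1))) := by
      calc _ ≤ (2 * (l : ℝ) + 1) ^ k * ∑ x ∈ J, ‖φ x - g x‖ := by gcongr
        _ ≤ _ := hg1
        _ ≤ _ := by gcongr
    have h2 : θ * N ^ (k + 1) + N * (k / (c * N) * (θ * N ^ (k + 1)))
        = (c * N) ^ k * (θ * (1 + k / c) / c ^ k * N) := by
      rw [mul_pow]; field_simp; ring
    rw [h2] at h1
    exact le_of_mul_le_mul_left h1 (by positivity)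
  have hmod : ∑ x ∈ J, (1 - ‖zeroExt f x‖) ≤ θ ^ 2 / c ^ k * N := by
    have h0 : 0 ≤ ∑ x ∈ J, (1 - ‖zeroExt f x‖) :=
      Finset.sum_nonneg fun x _ => by linarith [norm_zeroExt_le hf x]
    have h1 : (c * N) ^ k * ∑ x ∈ J, (1 - ‖zeroExt f x‖) ≤ θ ^ 2 * N ^ (k + 1) := by
      calc _ ≤ (2 * (l : ℝ) + 1) ^ k * ∑ x ∈ J, (1 - ‖zeroExt f x‖) := by gcongr
        _ = ∑ x ∈ J, ∑ u ∈ box (Fin k) l, (1 - ‖zeroExt f x‖) := by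
          simp only [Finset.sum_const, card_box, Fintype.card_fin, nsmul_eq_mul, ← Finset.mul_sum]
          push_cast
          rfl
        _ ≤ ∑ x ∈ J, ∑ u ∈ box (Fin k) l, (1 - (cubeProd u (zeroExt f) x).re) :=
          Finset.sum_le_sum fun x _ => Finset.sum_le_sum fun u _ =>
            (one_sub_re_cubeProd hf hφ (x, u)).1
        _ ≤ _ := sum_inner_le (W := fun c => 1 - (cubeProd c.2 (zeroExt f) c.1).re)
            (by rw [hm]; nlinarith [mul_nonneg (Nat.cast_nonneg (α := ℤ) k)
                  (Nat.cast_nonneg (α := ℤ) l), mul_nonneg (mul_nonneg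
                  (Nat.cast_nonneg (α := ℤ) k) (Nat.cast_nonneg (α := ℤ) k))
                  (Nat.cast_nonneg (α := ℤ) l), Nat.cast_nonneg (α := ℤ) l])
            fun c => one_sub_re_cubeProd_nonneg hf c
        _ ≤ _ := hsum
    have h2 : θ ^ 2 * N ^ (k + 1) = (c * N) ^ k * (θ ^ 2 / c ^ k * N) := by
      rw [mul_pow]; field_simp; ring
    rw [h2] at h1
    exact le_of_mul_le_mul_left h1 (by positivity)
  -- The shortened interval is long enough: `N - 1 - 2 * m ≥ N / 2 - 1 ≥ k`. This is where `2 * k +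
  -- 2 ≤ N` is used.
  obtain ⟨P, hP, hPg⟩ := hC (1 + m) (N - m) (2 ^ k * (k + 1) * θ / c ^ (k + 1)) g (by omega) hθ1 (by
    intro h hh x hx hA
    have h1 : (c * N) ^ (k + 1) * ‖cubeDiff h g x‖ ≤ 2 ^ k * (k + 1) * (θ * N ^ (k + 1)) := by
      calc _ ≤ (2 * (l : ℝ) + 1) ^ (k + 1) * ‖cubeDiff h g x‖ := by gcongr
        _ ≤ _ := hg2 (x, h) (mem_cubes_of_nonneg hh hx hA)
    rw [le_div_iff₀ (by positivity)]
    refine le_of_mul_le_mul_left ?_ (by positivity : (0 : ℝ) < (N : ℝ) ^ (k + 1))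
    calc _ = (c * N) ^ (k + 1) * ‖cubeDiff h g x‖ := by rw [mul_pow]; ring
      _ ≤ _ := h1
      _ = _ := by ring)
  refine ⟨P, hP, ?_⟩
  rw [l1Norm_eq, div_le_iff₀ hN0]
  have hpoly : ∑ x ∈ J, ‖g x - P x‖ ≤ C * (2 ^ k * (k + 1) * θ / c ^ (k + 1)) * N := by
    have h1 := Finset.sum_le_card_nsmul J (fun x => ‖g x - P x‖) _ fun x hx =>
      hPg x (Finset.mem_Icc.1 hx).1 (Finset.mem_Icc.1 hx).2
    rw [nsmul_eq_mul] at h1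
    have hmid : (1 + m) ∈ J := Finset.mem_Icc.2 ⟨le_rfl, by omega⟩
    have h0 := (norm_nonneg _).trans (hPg (1 + m) le_rfl (Finset.mem_Icc.1 hmid).2)
    rw [mul_comm _ (N : ℝ)]
    exact h1.trans (mul_le_mul_of_nonneg_right hJcard h0)
  calc _ ≤ ∑ x ∈ J, ‖zeroExt f x - e (P x)‖ + 4 * m :=
        sum_Icc_le_inner_add hm0 (by omega) fun n => by
          refine (norm_sub_le _ _).trans ?_
          rw [norm_e]
          linarith [norm_zeroExt_le hf n]
    _ ≤ ∑ x ∈ J, ((1 - ‖zeroExt f x‖) + 2 * Real.pi * ‖φ x - g x‖ + 2 * Real.pi * ‖g x - P x‖)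
        + 4 * m := by
        gcongr with x _
        exact norm_sub_e_le (hφ x) (norm_zeroExt_le hf x)
    _ = ∑ x ∈ J, (1 - ‖zeroExt f x‖) + 2 * Real.pi * ∑ x ∈ J, ‖φ x - g x‖
        + 2 * Real.pi * ∑ x ∈ J, ‖g x - P x‖ + 4 * m := by
        simp only [Finset.sum_add_distrib, Finset.mul_sum]
    _ ≤ θ ^ 2 / c ^ k * N + 2 * Real.pi * (θ * (1 + k / c) / c ^ k * N)
        + 2 * Real.pi * (C * (2 ^ k * (k + 1) * θ / c ^ (k + 1)) * N) + 4 * (κ * N) := by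
        gcongr
    _ = _ := by ring

theorem exists_nearPolynomial {k : ℕ} (hk : 1 ≤ k) {δ : ℝ} (hδ : 0 < δ) :
    ∃ ε > 0, NearPolynomial k ε δ := by
  obtain ⟨C, -, hC⟩ := exists_circle_polynomial_near k hk
  -- The margin costs `4 * κ ≤ δ / 2`. With `c` now fixed, the other errors tend to 0 with `θ`.
  set κ : ℝ := min (1 / 4) (δ / 8) with hκ
  have hκ0 : 0 < κ := by rw [hκ]; positivity
  set c : ℝ := κ / ((2 * k + 1) * (k + 1)) with hc
  have hc0 : 0 < c := by rw [hc]; positivity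
  have hev : ∀ᶠ θ in 𝓝[>] (0 : ℝ), 3 * (2 ^ k * (k + 1) * θ / c ^ (k + 1)) < 1 ∧
      θ ^ 2 / c ^ k + 2 * Real.pi * (θ * (1 + k / c) / c ^ k)
        + 2 * Real.pi * (C * (2 ^ k * (k + 1) * θ / c ^ (k + 1))) < δ / 2 := by
    refine nhdsWithin_le_nhds (Filter.Eventually.and ?_ ?_)
    · have : Continuous fun θ : ℝ => 3 * (2 ^ k * (k + 1) * θ / c ^ (k + 1)) := by fun_prop
      exact this.continuousAt.eventually_lt_const (by simp)
    · have : Continuous fun θ : ℝ => θ ^ 2 / c ^ k + 2 * Real.pi * (θ * (1 + k / c) / c ^ k)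
        + 2 * Real.pi * (C * (2 ^ k * (k + 1) * θ / c ^ (k + 1))) := by fun_prop
      exact this.continuousAt.eventually_lt_const (by simpa using hδ)
  obtain ⟨θ, ⟨h1, h2⟩, hθ⟩ := (hev.and self_mem_nhdsWithin).exists
  -- Chosen so that the total defect `2 ^ k * ε * N ^ (k + 1)` is at most `θ ^ 2 * N ^ (k + 1)`.
  refine ⟨min 1 (θ ^ 2 / 2 ^ k), by positivity, fun N hN M _ hM f hf hnorm => ?_⟩
  have hsum := sum_one_sub_re_le hk (by omega) hM (by positivity) (min_le_left _ _) hnorm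
  obtain ⟨P, hP, hPf⟩ := exists_polynomial_l1Norm_le hk hC hκ0 (min_le_left _ _) hc hθ.le h1 hN hf
    (hsum.trans (by
      have := min_le_right 1 (θ ^ 2 / 2 ^ k)
      rw [le_div_iff₀ (by positivity)] at this
      gcongr
      linarith))
  have := min_le_right (1 / 4) (δ / 8)
  exact ⟨P, hP, by linarith⟩

theorem NearPolynomial.mono {k : ℕ} {ε ε' δ δ' : ℝ} (h : NearPolynomial k ε δ) (hε : ε' ≤ ε)
    (hδ : δ ≤ δ') : NearPolynomial k ε' δ' := by
  intro N hN M _ hM f hf hnorm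
  obtain ⟨P, hP, hPf⟩ := h N hN M hM f hf (by linarith)
  exact ⟨P, hP, hPf.trans hδ⟩

/-- The trivial bound makes the set of admissible errors nonempty for every `ε`, so that its infimum
is meaningful. -/
theorem nearPolynomial_two {k : ℕ} (ε : ℝ) : NearPolynomial k ε 2 := by
  intro N hN M _ hM f hf _
  have hN0 : (0 : ℝ) < N := by exact_mod_cast (by omega : 0 < N)
  refine ⟨0, (isPolynomialOfDegreeLE_iff _).2 fun h x => by simp [cubeDiff], ?_⟩
  rw [l1Norm_eq, div_le_iff₀ hN0]
  have := Finset.sum_le_card_nsmul (Finset.Icc (1 : ℤ) N)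
    (fun n => ‖zeroExt f n - e ((0 : ℤ → UnitAddCircle) n)‖) 2 fun n _ => by
      refine (norm_sub_le _ _).trans ?_
      rw [norm_e]
      linarith [norm_zeroExt_le hf n]
  refine this.trans (le_of_eq ?_)
  simp [mul_comm]

/-! ### Packaging the estimates in one modulus. -/

/-- A family of implications between small parameters can be packaged in a single modulus. -/
theorem exists_modulus {R : ℝ → ℝ → Prop} (h0 : R 0 0) (hR : ∀ δ > 0, ∃ ε > 0, R ε δ)
    (hmono : ∀ {ε ε' δ δ'}, R ε δ → ε' ≤ ε → δ ≤ δ' → R ε' δ') (hbig : ∀ ε, ∃ δ, 0 ≤ δ ∧ R ε δ) :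
    ∃ c : ℝ → ℝ, Tendsto c (𝓝[≥] 0) (𝓝 0) ∧ ∀ ε, 0 ≤ ε → R ε (c ε) := by
  have hbdd : ∀ ε, BddBelow {δ | 0 ≤ δ ∧ R ε δ} := fun ε => ⟨0, fun δ hδ => hδ.1⟩
  have hnonneg : ∀ ε, 0 ≤ sInf {δ | 0 ≤ δ ∧ R ε δ} := fun ε => Real.sInf_nonneg fun δ hδ => hδ.1
  -- The infimum need not be attained; adding `ε` exceeds it when `ε > 0`, and `ε = 0` is covered by
  -- `h0`.
  refine ⟨fun ε => sInf {δ | 0 ≤ δ ∧ R ε δ} + ε, ?_, fun ε hε => ?_⟩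
  · rw [Metric.tendsto_nhdsWithin_nhds]
    intro δ hδ
    obtain ⟨ε, hε, hεδ⟩ := hR (δ / 4) (by positivity)
    refine ⟨min ε (δ / 2), by positivity, fun x hx hdist => ?_⟩
    rw [Set.mem_Ici] at hx
    rw [Real.dist_0_eq_abs, abs_of_nonneg hx] at hdist
    rw [Real.dist_0_eq_abs, abs_of_nonneg (add_nonneg (hnonneg x) hx)]
    have h1 : sInf {δ | 0 ≤ δ ∧ R x δ} ≤ δ / 4 := csInf_le (hbdd x)
      ⟨by positivity, hmono hεδ (hdist.le.trans (min_le_left _ _)) le_rfl⟩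
    have h2 := hdist.trans_le (min_le_right _ _)
    linarith
  · rcases hε.eq_or_lt with rfl | hε
    · exact hmono h0 le_rfl (by simpa using hnonneg 0)
    · obtain ⟨δ, hδ, hlt⟩ := Real.lt_sInf_add_pos (s := {δ | 0 ≤ δ ∧ R ε δ}) (hbig ε) hε
      exact hmono hδ.2 le_rfl hlt.le

end GowersInterval

end

theorem theorem1p5 (k : ℕ) (hk : 1 ≤ k) :
    ∃ (N₀ : ℕ) (c : ℝ → ℝ), Tendsto c (𝓝[≥] 0) (𝓝 0) ∧
      ∀ N : ℕ, 1 ≤ N → N₀ ≤ N →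
      -- the norm on `[N]` may be computed in any cyclic group of order `M > 2 ^ k * N`
      ∀ (M : ℕ) [NeZero M], 2 ^ k * N < M →
      ∀ f : GowersInterval.Interval N → ℂ, (∀ n, ‖f n‖ ≤ 1) →
        (GowersInterval.gowersNormInterval k M f = 1 ↔
          ∃ P : ℤ → UnitAddCircle, GowersInterval.IsPolynomialOfDegreeLE ((k : ℤ) - 1) P ∧
            ∀ n, f n = GowersInterval.e (P n)) ∧
        (∀ ε : ℝ, 0 ≤ ε → 1 - ε ≤ GowersInterval.gowersNormInterval k M f →
          ∃ P : ℤ → UnitAddCircle, GowersInterval.IsPolynomialOfDegreeLE ((k : ℤ) - 1) P ∧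
            GowersInterval.l1Norm (fun n => f n - GowersInterval.e (P n)) ≤ c ε) := by
  obtain ⟨c, hc, H⟩ := GowersInterval.exists_modulus (R := GowersInterval.NearPolynomial k)
    (GowersInterval.nearPolynomial_zero hk) (fun δ hδ => GowersInterval.exists_nearPolynomial hk hδ)
    GowersInterval.NearPolynomial.mono
    (fun ε => ⟨2, zero_le_two, GowersInterval.nearPolynomial_two ε⟩)
  refine ⟨2 * k + 2, c, hc, fun N hN1 hN M _ hM f hf => ⟨⟨fun hnorm => ?_, ?_⟩, fun ε hε hnorm =>
    H ε hε N hN M hM f hf hnorm⟩⟩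
  · obtain ⟨P, hP, hPf⟩ := GowersInterval.nearPolynomial_zero hk N hN M hM f hf (by simp [hnorm])
    refine ⟨P, hP, fun n => ?_⟩
    have hN0 : (0 : ℝ) < N := by exact_mod_cast hN1
    rw [GowersInterval.l1Norm, div_le_iff₀ hN0, zero_mul] at hPf
    have := (Finset.sum_eq_zero_iff_of_nonneg fun n _ => norm_nonneg _).1
      (le_antisymm hPf (Finset.sum_nonneg fun n _ => norm_nonneg _)) n (Finset.mem_univ n)
    exact sub_eq_zero.1 (norm_eq_zero.1 this)
  · rintro ⟨P, hP, hfP⟩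
    exact GowersInterval.gowersNormInterval_eq_one hk hN1 hM hP hfP
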